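/- **Model.** Let $\Phi_W=\{x_i\}$ and $\Phi_L=\{y_k\}$ be independent homogeneous Poisson point processes on $\mathbb R^2$ with intensities $\lambda_W,\lambda_L>0$ (Wi-Fi access points, AP, and LTE base stations, eNB). The path loss over distance $d$ is $l(d)=(4\pi/\lambda_c)^2d^{\alpha}$ with wavelength $\lambda_c>0$ and exponent $\alpha>0$. Transmit powers $P_W,P_L$ and sensing thresholds $\Gamma_{cs},\Gamma_{ed},\Gamma^L$ are positive. Each AP $x_i$ has a timer $t^W_i$ uniform on $[0,1]$ and each eNB $y_k$ has a timer $t^L_k$ uniform on $[a,b]$. The fading of each channel is exponential with rate $\mu>0$: $G^W_{ji}$ from AP $x_j$ to AP $x_i$, $G^{LW}_{mi}$ from eNB $y_m$ to AP $x_i$, $G^{WL}_{jk}$ from AP $x_j$ to eNB $y_k$, $G^L_{mk}$ from eNB $y_m$ to eNB $y_k$. All timers and fading variables are mutually independent and independent of $(\Phi_W,\Phi_L)$. Under the listen-before-talk and random back-off mechanism the medium access indicators are $$e^W_i=\prod_{x_j\in\Phi_W\setminus\{x_i\}}\Big(\mathbf 1_{t^W_j\ge t^W_i}+\mathbf 1_{t^W_j<t^W_i}\mathbf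 1_{G^W_{ji}/l(\|x_j-x_i\|)\le\Gamma_{cs}/P_W}\Big)\prod_{y_m\in\Phi_L}\Big(\mathbf 1_{t^L_m\ge t^W_i}+\mathbf 1_{t^L_m<t^W_i}\mathbf 1_{G^{LW}_{mi}/l(\|y_m-x_i\|)\le\Gamma_{ed}/P_L}\Big),$$ $$e^L_k=\prod_{x_j\in\Phi_W}\Big(\mathbf 1_{t^W_j\ge t^L_k}+\mathbf 1_{t^W_j<t^L_k}\mathbf 1_{G^{WL}_{jk}/l(\|x_j-y_k\|)\le\Gamma^L/P_W}\Big)\prod_{y_m\in\Phi_L\setminus\{y_k\}}\Big(\mathbf 1_{t^L_m\ge t^L_k}+\mathbf 1_{t^L_m<t^L_k}\mathbf 1_{G^L_{mk}/l(\|y_m-y_k\|)\le\Gamma^L/P_L}\Big).$$ The medium access probability (MAP) of the typical AP (eNB) is the Palm probability that its indicator equals $1$, i.e. for every Borel set $B\subset\mathbb R^2$ with $0<|B|<\infty$, $$p^W_{4,\mathrm{MAP}}=\frac{1}{\lambda_W|B|}\,\mathbb E\sum_{i:\,x_i\in B}e^W_i,\qquad p^L_{4,\mathrm{MAP}}=\frac{1}{\lambda_L|B|}\,\mathbb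 E\sum_{k:\,y_k\in B}e^L_k .$$ (It is part of the claim that these ratios do not depend on $B$.) Put $$N^W_3(\Gamma)=\lambda_W\int_{\mathbb R^2}e^{-\mu\frac{\Gamma}{P_W}l(\|x\|)}\,dx,\qquad N^L_3(\Gamma)=\lambda_L\int_{\mathbb R^2}e^{-\mu\frac{\Gamma}{P_L}l(\|x\|)}\,dx,\qquad N^W=N^W_3(\Gamma_{cs}).$$ **Statement.** If LTE follows the listen-before-talk and random back-off mechanism with $(a,b)=(1,2)$, then $$p^W_{4,\mathrm{MAP}}=\frac{1-e^{-N^W}}{N^W},\qquad p^L_{4,\mathrm{MAP}}=e^{-N^W_3(\Gamma^L)}\,\frac{1-e^{-N^L_3(\Gamma^L)}}{N^L_3(\Gamma^L)} .$$ Moreover $p^W_{4,\mathrm{MAP}}$ is the same as if LTE were absent, i.e. as when the product over $\Phi_L$ in $e^W_i$ is omitted. -/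

import Mathlib

open MeasureTheory ProbabilityTheory
open scoped ENNReal

namespace Coexistence

/-- The Euclidean plane, with Lebesgue measure as `volume`. -/
abbrev Plane : Type := EuclideanSpace ℝ (Fin 2)

/-! ## System parameters -/

/-- Deterministic system parameters; all powers and thresholds are on the linear scale. -/
structure Params where
  /-- intensity of the Wi-Fi access points -/
  lamW : ℝ
  /-- intensity of the LTE eNBs -/
  lamL : ℝ
  /-- transmit power of an access point -/
  PW : ℝ
  /-- transmit power of an eNB -/
  PL : ℝ
  /-- carrier sensing threshold (AP sensing AP) -/
  Gcs : ℝ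
  /-- energy detection threshold (AP sensing eNB) -/
  Ged : ℝ
  /-- common sensing threshold of the eNBs -/
  Glte : ℝ
  /-- rate of the exponential fading -/
  mu : ℝ
  /-- wavelength of the carrier -/
  wavelength : ℝ
  /-- path loss exponent -/
  alpha : ℝ
  lamW_pos : 0 < lamW
  lamL_pos : 0 < lamL
  PW_pos : 0 < PW
  PL_pos : 0 < PL
  Gcs_pos : 0 < Gcs
  Ged_pos : 0 < Ged
  Glte_pos : 0 < Glte
  mu_pos : 0 < mu
  wavelength_pos : 0 < wavelength
  alpha_pos : 0 < alpha

/-- Path loss over distance `d` on the linear scale, i.e. `10 ^ (L / 10)` where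
`L = 20 log₁₀ (4π / wavelength) + 10 alpha log₁₀ d` is the path loss in dB. -/
noncomputable def Params.pathLoss (p : Params) (d : ℝ) : ℝ :=
  (4 * Real.pi / p.wavelength) ^ 2 * d ^ p.alpha

/-- `N^W_0(y, r, Γ)`: expected number of APs outside `B(0, r)` whose power received at `y`
exceeds `Γ`. -/
noncomputable def Params.NW0 (p : Params) (y : Plane) (r G : ℝ) : ℝ :=
  p.lamW * ∫ x in (Metric.closedBall (0 : Plane) r)ᶜ,
    Real.exp (-(p.mu * (G / p.PW) * p.pathLoss ‖x - y‖))

/-- `N^L_0(y, r, Γ)`: expected number of eNBs outside `B(0, r)` whose power received at `y`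
exceeds `Γ`. -/
noncomputable def Params.NL0 (p : Params) (y : Plane) (r G : ℝ) : ℝ :=
  p.lamL * ∫ x in (Metric.closedBall (0 : Plane) r)ᶜ,
    Real.exp (-(p.mu * (G / p.PL) * p.pathLoss ‖x - y‖))

/-- `N^W_3(Γ) = N^W_0(o, 0, Γ)`. -/
noncomputable def Params.NW3 (p : Params) (G : ℝ) : ℝ := p.NW0 0 0 G

/-- `N^L_3(Γ) = N^L_0(o, 0, Γ)`. -/
noncomputable def Params.NL3 (p : Params) (G : ℝ) : ℝ := p.NL0 0 0 G

/-- `N^W = N^W_0(o, 0, Γ_cs)`. -/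
noncomputable def Params.NW (p : Params) : ℝ := p.NW0 0 0 p.Gcs

/-! ## Point processes -/

/-- The counting measure of the (enumerated) random points `x 0, x 1, …`. -/
noncomputable def pointMeasure {Ω : Type*} (x : ℕ → Ω → Plane) (ω : Ω) : Measure Plane :=
  Measure.sum fun i => Measure.dirac (x i ω)

/-- `x` enumerates the points of a homogeneous Poisson point process of intensity `lam` on the
plane: the number of points in a Borel set of finite area `A` is Poisson with mean `lam * A`, and
the numbers of points in disjoint sets are independent. For `lam > 0` such a process has almost
surely infinitely many points, hence an enumeration by `ℕ`. -/
structure IsPoissonProcess {Ω : Type*} [MeasurableSpace Ω] (P : Measure Ω) (lam : ℝ)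
    (x : ℕ → Ω → Plane) : Prop where
  measurable : ∀ i, Measurable (x i)
  hasLaw_count : ∀ B : Set Plane, MeasurableSet B → volume B ≠ ∞ →
    HasLaw (fun ω => pointMeasure x ω B)
      ((poissonMeasure (Real.toNNReal (lam * (volume B).toReal))).map
        (Nat.cast : ℕ → ℝ≥0∞)) P
  iIndepFun_count : ∀ (n : ℕ) (B : Fin n → Set Plane), (∀ k, MeasurableSet (B k)) →
    (∀ k, volume (B k) ≠ ∞) → Pairwise (fun k l => Disjoint (B k) (B l)) →
    iIndepFun (fun k ω => pointMeasure x ω (B k)) P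

/-- The Palm probability of the mark event `A` for a point process `x` of intensity `lam`, computed
with the observation window `B`: the expected number of points of the process that lie in `B` and
whose mark satisfies the event (`A i` for the point `x i`), over the expected number `lam * |B|`
of all points in `B`. -/
noncomputable def palmProb {Ω : Type*} [MeasurableSpace Ω] (P : Measure Ω) (lam : ℝ)
    (x : ℕ → Ω → Plane) (A : ℕ → Set Ω) (B : Set Plane) : ℝ≥0∞ :=
  (∫⁻ ω, ∑' i, ({ω' | x i ω' ∈ B} ∩ A i).indicator (fun _ => (1 : ℝ≥0∞)) ω ∂P) /
    (ENNReal.ofReal lam * volume B)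

/-! ## The network -/

/-- Labels of the real-valued marks: back-off timers of APs (`tW`) and eNBs (`tL`), and the fading
of the channels AP to AP (`gW`), eNB to AP (`gLW`), AP to eNB (`gWL`), eNB to eNB (`gL`); the first
index is the transmitter and the second the receiver. -/
inductive Mark : Type
  | tW (i : ℕ)
  | tL (k : ℕ)
  | gW (j i : ℕ)
  | gLW (m i : ℕ)
  | gWL (j k : ℕ)
  | gL (m k : ℕ)

/-- Law of each mark: timers are uniform on `[0, 1]` (APs) and `[a, b]` (eNBs), the fading variables
are exponential with rate `mu`. -/
noncomputable def markLaw (mu a b : ℝ) : Mark → Measure ℝ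
  | .tW _ => cond volume (Set.Icc 0 1)
  | .tL _ => cond volume (Set.Icc a b)
  | .gW _ _ => expMeasure mu
  | .gLW _ _ => expMeasure mu
  | .gWL _ _ => expMeasure mu
  | .gL _ _ => expMeasure mu

/-- Coexisting Wi-Fi and LTE networks where LTE uses listen-before-talk with random back-off on
`[a, b]`: two independent Poisson processes, and independent marks that are independent of all
locations. -/
structure Network {Ω : Type*} [MeasurableSpace Ω] (P : Measure Ω) (p : Params) (a b : ℝ) where
  /-- locations of the access points -/
  x : ℕ → Ω → Plane
  /-- locations of the eNBs -/
  y : ℕ → Ω → Plane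
  /-- timers and fading variables -/
  mark : Mark → Ω → ℝ
  poisson_x : IsPoissonProcess P p.lamW x
  poisson_y : IsPoissonProcess P p.lamL y
  measurable_mark : ∀ m, Measurable (mark m)
  hasLaw_mark : ∀ m, HasLaw (mark m) (markLaw p.mu a b m) P
  iIndepFun_mark : iIndepFun mark P
  indepFun_locations : IndepFun (fun ω i => x i ω) (fun ω k => y k ω) P
  indepFun_locations_mark :
    IndepFun (fun ω => ((fun i => x i ω : ℕ → Plane), (fun k => y k ω : ℕ → Plane)))
      (fun ω m => mark m ω) P

namespace Network

variable {Ω : Type*} [MeasurableSpace Ω] {P : Measure Ω} {p : Params} {a b : ℝ}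

/-- No other AP with a smaller timer is received by AP `i` with power above `Γ_cs`. -/
def noAPContender (S : Network P p a b) (i : ℕ) : Set Ω :=
  {ω | ∀ j, j ≠ i → S.mark (.tW j) ω ≥ S.mark (.tW i) ω ∨
    S.mark (.gW j i) ω / p.pathLoss ‖S.x j ω - S.x i ω‖ ≤ p.Gcs / p.PW}

/-- The event that the medium access indicator `e_i^W` of AP `i` equals one: no AP (eNB) with a
smaller timer is received by AP `i` with power above `Γ_cs` (`Γ_ed`). -/
def accessW (S : Network P p a b) (i : ℕ) : Set Ω :=
  S.noAPContender i ∩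
    {ω | ∀ m, S.mark (.tL m) ω ≥ S.mark (.tW i) ω ∨
      S.mark (.gLW m i) ω / p.pathLoss ‖S.y m ω - S.x i ω‖ ≤ p.Ged / p.PL}

/-- The event that AP `i` gets access when there is no LTE network. -/
def accessWithoutLTE (S : Network P p a b) (i : ℕ) : Set Ω := S.noAPContender i

/-- The event that the medium access indicator `e_k^L` of eNB `k` equals one: no AP or eNB with a
smaller timer is received by eNB `k` with power above `Γ^L`. -/
def accessL (S : Network P p a b) (k : ℕ) : Set Ω :=
  {ω | ∀ j, S.mark (.tW j) ω ≥ S.mark (.tL k) ω ∨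
      S.mark (.gWL j k) ω / p.pathLoss ‖S.x j ω - S.y k ω‖ ≤ p.Glte / p.PW} ∩
    {ω | ∀ m, m ≠ k → S.mark (.tL m) ω ≥ S.mark (.tL k) ω ∨
      S.mark (.gL m k) ω / p.pathLoss ‖S.y m ω - S.y k ω‖ ≤ p.Glte / p.PL}

/-- Medium access probability of the typical AP (window `B`). -/
noncomputable def mapW (S : Network P p a b) (B : Set Plane) : ℝ≥0∞ :=
  palmProb P p.lamW S.x S.accessW B

/-- Medium access probability of the typical AP when LTE is absent (window `B`). -/
noncomputable def mapWithoutLTE (S : Network P p a b) (B : Set Plane) : ℝ≥0∞ :=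
  palmProb P p.lamW S.x S.accessWithoutLTE B

/-- Medium access probability of the typical eNB (window `B`). -/
noncomputable def mapL (S : Network P p a b) (B : Set Plane) : ℝ≥0∞ :=
  palmProb P p.lamL S.y S.accessL B

end Network

end Coexistence

/-! Fix the position u and the timer value s of one transmitter. Given all locations, a competitor
at v blocks it with probability `T (Set.Iio s) * p.detect c u v`, where T is the competitor's timer
law, and different competitors act independently. The conditional access probability is therefore a
product of factors one minus blocking probability. By Mecke's formula the typical point sees its own
network as an unchanged Poisson process, and the Laplace functional turns each product into exp(-λ
T(timer < s) ∫ detect). The integral does not depend on u by translation invariance, so the window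
cancels; this is `palmProb_winSet`.

It remains to average over s. On a timer interval [a, a+1] the own network contributes exp(-N(s-a)),
with mean (1 - e^{-N})/N. For the intervals [0,1] and [1,2], an eNB timer never precedes an AP
timer, so the LTE factor seen by an AP is 1; every AP timer almost surely precedes a given eNB
timer, so the Wi-Fi factor seen by an eNB is the constant e^{-N^W_3}.

The Poisson process is given only through its counts, so Mecke's formula (`tsum_lintegral_thinProd`)
and the Laplace functional (`lintegral_thinProd`) are derived from them. The plane is partitioned
according to which of the first n sets of a countable basis contain a point. The blocking
probability H is replaced by its infimum over pairs of cells, and by zero on the cell of the first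
point. Then the product attached to points of a cell A involves only points outside A and is
independent of the count in A. Lower semicontinuity and vanishing on the diagonal make these
approximations increase to H, and dominated convergence finishes. -/

namespace Coexistence

/-! ## Poisson integrals -/

/-- `exp (-t)` for a finite extended nonnegative real `t`. -/
noncomputable def expNeg (t : ℝ≥0∞) : ℝ≥0∞ := ENNReal.ofReal (Real.exp (-t.toReal))

lemma expNeg_zero : expNeg 0 = 1 := by simp [expNeg]

lemma expNeg_le_one (t : ℝ≥0∞) : expNeg t ≤ 1 := by
  rw [expNeg, ENNReal.ofReal_le_one, Real.exp_le_one_iff]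
  simp

lemma expNeg_add {s t : ℝ≥0∞} (hs : s ≠ ∞) (ht : t ≠ ∞) :
    expNeg (s + t) = expNeg s * expNeg t := by
  rw [expNeg, expNeg, expNeg, ENNReal.toReal_add hs ht, neg_add, Real.exp_add,
    ENNReal.ofReal_mul (Real.exp_pos _).le]

lemma expNeg_sum {ι : Type*} (s : Finset ι) (f : ι → ℝ≥0∞) (hf : ∀ i ∈ s, f i ≠ ∞) :
    expNeg (∑ i ∈ s, f i) = ∏ i ∈ s, expNeg (f i) := by
  classical
  induction s using Finset.induction_on with
  | empty => simp [expNeg_zero]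
  | insert a s ha ih =>
    rw [Finset.sum_insert ha, Finset.prod_insert ha, expNeg_add (hf a (by simp)), ih]
    · exact fun i hi => hf i (by simp [hi])
    · exact ENNReal.sum_ne_top.2 fun i hi => hf i (by simp [hi])

lemma measurable_expNeg : Measurable expNeg := by
  unfold expNeg
  fun_prop

/-- Finiteness of the limit matters: `toReal` sends ∞ to 0, so `expNeg ∞ = 1` and continuity fails
there. -/
lemma tendsto_expNeg {u : ℕ → ℝ≥0∞} {t : ℝ≥0∞} (ht : t ≠ ∞)
    (h : Filter.Tendsto u Filter.atTop (nhds t)) :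
    Filter.Tendsto (fun n => expNeg (u n)) Filter.atTop (nhds (expNeg t)) := by
  refine ENNReal.tendsto_ofReal ?_
  exact (Real.continuous_exp.tendsto _).comp ((ENNReal.tendsto_toReal ht).comp h).neg

lemma lintegral_poissonMeasure (r : NNReal) (f : ℕ → ℝ≥0∞) :
    ∫⁻ n, f n ∂(poissonMeasure r) =
      ∑' n, ENNReal.ofReal (Real.exp (-r) * r ^ n / n.factorial) * f n := by
  simp [poissonMeasure, lintegral_sum_measure, lintegral_smul_measure]

/-- The Poisson generating function at 1 - c: each of the points survives independently with
probability 1 - c. -/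
lemma lintegral_poisson_pow (r : NNReal) {c : ℝ≥0∞} (hc : c ≤ 1) :
    ∫⁻ t, (1 - c) ^ t.toReal ∂((poissonMeasure r).map (Nat.cast : ℕ → ℝ≥0∞)) =
      expNeg (r * c) := by
  have hc' : c ≠ ∞ := ne_top_of_le_ne_top ENNReal.one_ne_top hc
  rw [lintegral_map (by fun_prop) .of_discrete, lintegral_poissonMeasure]
  have h1 : ∀ n : ℕ, ENNReal.ofReal (Real.exp (-r) * r ^ n / n.factorial) *
      (1 - c) ^ (n : ℝ≥0∞).toReal =
      ENNReal.ofReal (Real.exp (-r) * ((r * (1 - c.toReal)) ^ n / n.factorial)) := by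
    intro n
    have h0 : 1 - c = ENNReal.ofReal (1 - c.toReal) := by
      rw [ENNReal.ofReal_sub _ ENNReal.toReal_nonneg, ENNReal.ofReal_toReal hc',
        ENNReal.ofReal_one]
    have h2 : 0 ≤ 1 - c.toReal := by
      have := ENNReal.toReal_mono ENNReal.one_ne_top hc
      simp at this
      linarith
    rw [ENNReal.toReal_natCast, ENNReal.rpow_natCast, h0, ← ENNReal.ofReal_pow h2,
      ← ENNReal.ofReal_mul (by positivity)]
    congr 1
    rw [mul_pow]
    ring
  simp_rw [h1]
  have h2 : 0 ≤ 1 - c.toReal := by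
    have := ENNReal.toReal_mono ENNReal.one_ne_top hc
    simp at this
    linarith
  have hs : HasSum (fun n : ℕ => Real.exp (-r) * ((r * (1 - c.toReal)) ^ n / n.factorial))
      (Real.exp (-r) * Real.exp (r * (1 - c.toReal))) := by
    rw [Real.exp_eq_exp_ℝ]
    exact (NormedSpace.expSeries_div_hasSum_exp ((r : ℝ) * (1 - c.toReal))).mul_left _
  rw [← ENNReal.ofReal_tsum_of_nonneg (fun n => by positivity) hs.summable, hs.tsum_eq,
    expNeg, ← Real.exp_add]
  congr 2
  simp
  ring

lemma lintegral_poisson_id (r : NNReal) :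
    ∫⁻ t, t ∂((poissonMeasure r).map (Nat.cast : ℕ → ℝ≥0∞)) = r := by
  rw [lintegral_map (by fun_prop) .of_discrete, lintegral_poissonMeasure,
    tsum_eq_zero_add' ENNReal.summable]
  have h1 : ∀ n : ℕ, ENNReal.ofReal (Real.exp (-r) * r ^ (n + 1) / (n + 1).factorial) *
      ((n + 1 : ℕ) : ℝ≥0∞) = r * ENNReal.ofReal (Real.exp (-r) * r ^ n / n.factorial) := by
    intro n
    rw [← ENNReal.ofReal_natCast, ← ENNReal.ofReal_coe_nnreal,
      ← ENNReal.ofReal_mul (by positivity), ← ENNReal.ofReal_mul (by positivity)]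
    congr 1
    rw [Nat.factorial_succ]
    push_cast
    field_simp
    ring
  simp_rw [h1]
  rw [ENNReal.tsum_mul_left, ← ENNReal.ofReal_tsum_of_nonneg (fun n => by positivity)
    (hasSum_one_poissonMeasure r).summable, (hasSum_one_poissonMeasure r).tsum_eq]
  simp

/-! ## Thinning products along an enumeration -/

/-- The product of `1 - φ` over the points of `x` whose index is not in `E`. -/
noncomputable def thinProd {α : Type*} (x : ℕ → α) (E : Finset ℕ) (φ : α → ℝ≥0∞) : ℝ≥0∞ :=
  ⨅ k : ℕ, ∏ j ∈ Finset.range k \ E, (1 - φ (x j))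

lemma antitone_prod_range_sdiff (E : Finset ℕ) (f : ℕ → ℝ≥0∞) :
    Antitone fun k : ℕ => ∏ j ∈ Finset.range k \ E, (1 - f j) := by
  intro k l hkl
  refine Finset.prod_le_prod_of_subset_of_le_one' ?_ fun j _ _ => tsub_le_self
  exact Finset.sdiff_subset_sdiff (Finset.range_mono hkl) le_rfl

lemma thinProd_le_one {α : Type*} (x : ℕ → α) (E : Finset ℕ) (φ : α → ℝ≥0∞) :
    thinProd x E φ ≤ 1 :=
  iInf_le_of_le 0 (by simp)

lemma measurable_thinProd {Ω α : Type*} [MeasurableSpace Ω] [MeasurableSpace α]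
    {x : ℕ → Ω → α} (hx : ∀ i, Measurable (x i)) (E : Finset ℕ) {φ : Ω → α → ℝ≥0∞}
    (hφ : Measurable (Function.uncurry φ)) :
    Measurable fun ω => thinProd (fun i => x i ω) E (φ ω) := by
  refine Measurable.iInf fun k => Finset.measurable_prod _ fun j _ => ?_
  exact measurable_const.sub (hφ.comp (measurable_id.prodMk (hx j)))

/-- Factors with φ = 0 equal 1, so the excluded indices may be put back. This removes the dependence
on the index of the distinguished point. -/
lemma thinProd_eq_empty {α : Type*} (x : ℕ → α) (E : Finset ℕ) (φ : α → ℝ≥0∞)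
    (h : ∀ j ∈ E, φ (x j) = 0) : thinProd x E φ = thinProd x ∅ φ := by
  unfold thinProd
  refine iInf_congr fun k => ?_
  rw [Finset.sdiff_empty]
  refine Finset.prod_subset Finset.sdiff_subset fun j hj hj' => ?_
  simp only [Finset.mem_sdiff, hj, true_and, not_not] at hj'
  simp [h j hj']

lemma pointMeasure_apply {Ω : Type*} (x : ℕ → Ω → Plane) (ω : Ω) {D : Set Plane}
    (hD : MeasurableSet D) :
    pointMeasure x ω D = ∑' i, D.indicator (fun _ => (1 : ℝ≥0∞)) (x i ω) := by
  rw [pointMeasure, Measure.sum_apply _ hD]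
  refine tsum_congr fun i => ?_
  rw [Measure.dirac_apply' _ hD]
  rfl

lemma exists_finset_pointMeasure {Ω : Type*} (x : ℕ → Ω → Plane) (ω : Ω) {D : Set Plane}
    (hD : MeasurableSet D) (hfin : pointMeasure x ω D ≠ ∞) :
    ∃ J : Finset ℕ, (∀ j, j ∈ J ↔ x j ω ∈ D) ∧ pointMeasure x ω D = J.card := by
  rw [pointMeasure_apply x ω hD] at hfin ⊢
  have h := ENNReal.finite_const_le_of_tsum_ne_top hfin one_ne_zero
  have hJ : ∀ j, j ∈ h.toFinset ↔ x j ω ∈ D := by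
    intro j
    by_cases hj : x j ω ∈ D <;> simp [hj]
  refine ⟨h.toFinset, hJ, ?_⟩
  rw [tsum_eq_sum (s := h.toFinset)]
  · rw [Finset.sum_congr rfl (g := fun _ => 1)]
    · simp
    · intro j hj
      rw [Set.indicator_of_mem ((hJ j).1 hj)]
  · intro j hj
    rw [Set.indicator_of_notMem (fun h' => hj ((hJ j).2 h'))]

/-- The step function with value `c b` on `D b`. -/
noncomputable def stepFun {ι : Type*} [Fintype ι] (D : ι → Set Plane) (c : ι → ℝ≥0∞) (z : Plane) :
    ℝ≥0∞ :=
  ∑ b, (D b).indicator (fun _ => c b) z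

open Classical in
-- A point lies in at most one set, so the sum becomes a product, which can be exchanged with the
-- product over points.
lemma one_sub_stepFun {ι : Type*} [Fintype ι] (D : ι → Set Plane) (c : ι → ℝ≥0∞)
    (hdisj : Pairwise fun b b' => Disjoint (D b) (D b')) (z : Plane) :
    1 - stepFun D c z = ∏ b, if z ∈ D b then 1 - c b else 1 := by
  unfold stepFun
  by_cases h : ∃ b, z ∈ D b
  · obtain ⟨b, hb⟩ := h
    have hne : ∀ b', b' ≠ b → z ∉ D b' := fun b' hb' hz =>
      Set.disjoint_left.1 (hdisj hb') hz hb
    rw [Fintype.sum_eq_single b (fun b' hb' => by simp [hne b' hb']),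
      Fintype.prod_eq_single b (fun b' hb' => by simp [hne b' hb'])]
    simp [hb]
  · push Not at h
    simp [h]

/-- Only finitely many points lie in the sets, so the partial products are constant from some K on;
grouping the factors by set leaves one power per count. -/
lemma thinProd_stepFun {Ω ι : Type*} [Fintype ι] (x : ℕ → Ω → Plane) (ω : Ω)
    (D : ι → Set Plane) (c : ι → ℝ≥0∞) (hD : ∀ b, MeasurableSet (D b))
    (hdisj : Pairwise fun b b' => Disjoint (D b) (D b'))
    (hfin : ∀ b, pointMeasure x ω (D b) ≠ ∞) :
    thinProd (fun i => x i ω) ∅ (stepFun D c) =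
      ∏ b, (1 - c b) ^ (pointMeasure x ω (D b)).toReal := by
  classical
  choose J hJ hcard using fun b => exists_finset_pointMeasure x ω (hD b) (hfin b)
  obtain ⟨K, hK⟩ : ∃ K : ℕ, ∀ b, J b ⊆ Finset.range K := by
    obtain ⟨K, hK⟩ := (Finset.univ.biUnion J).exists_nat_subset_range
    exact ⟨K, fun b => (Finset.subset_biUnion_of_mem J (Finset.mem_univ b)).trans hK⟩
  have key : ∀ k, K ≤ k → ∏ j ∈ Finset.range k \ ∅, (1 - stepFun D c (x j ω)) =
      ∏ b, (1 - c b) ^ (pointMeasure x ω (D b)).toReal := by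
    intro k hk
    simp_rw [one_sub_stepFun D c hdisj]
    rw [Finset.prod_comm]
    refine Finset.prod_congr rfl fun b _ => ?_
    rw [hcard b, ENNReal.toReal_natCast, ENNReal.rpow_natCast, Finset.sdiff_empty,
      ← Finset.prod_filter, Finset.prod_const]
    congr 2
    ext j
    simp only [Finset.mem_filter, ← hJ, and_iff_right_iff_imp]
    exact fun hj => Finset.range_mono hk (hK b hj)
  have hanti := antitone_prod_range_sdiff ∅ fun j => stepFun D c (x j ω)
  refine le_antisymm ((iInf_le _ K).trans (key K le_rfl).le) (le_iInf fun k => ?_)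
  rw [← key (max K k) (le_max_left _ _)]
  exact hanti (le_max_right _ _)

lemma lintegral_stepFun {ι : Type*} [Fintype ι] (D : ι → Set Plane) (c : ι → ℝ≥0∞)
    (hD : ∀ b, MeasurableSet (D b)) :
    ∫⁻ z, stepFun D c z = ∑ b, c b * volume (D b) := by
  unfold stepFun
  rw [lintegral_finsetSum _ fun b _ => measurable_const.indicator (hD b)]
  exact Finset.sum_congr rfl fun b _ => by rw [lintegral_indicator_const (hD b)]

/-! ### Moments of counts and of step-function products -/

namespace IsPoissonProcess

variable {Ω : Type*} [MeasurableSpace Ω] {P : Measure Ω} {lam : ℝ} {x : ℕ → Ω → Plane}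

lemma measurable_count (h : IsPoissonProcess P lam x) {D : Set Plane} (hD : MeasurableSet D) :
    Measurable fun ω => pointMeasure x ω D := by
  simp_rw [pointMeasure_apply x _ hD]
  exact Measurable.tsum fun i => (measurable_const.indicator hD).comp (h.measurable i)

lemma iIndepFun_count_fintype (h : IsPoissonProcess P lam x) {ι : Type*} [Fintype ι]
    (D : ι → Set Plane) (hD : ∀ b, MeasurableSet (D b)) (hfin : ∀ b, volume (D b) ≠ ∞)
    (hdisj : Pairwise fun b b' => Disjoint (D b) (D b')) :
    iIndepFun (fun b ω => pointMeasure x ω (D b)) P := by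
  let e := Fintype.equivFin ι
  have := h.iIndepFun_count (Fintype.card ι) (fun k => D (e.symm k)) (fun k => hD _)
    (fun k => hfin _) fun k l hkl => hdisj (e.symm.injective.ne hkl)
  exact iIndepFun.of_precomp (g := e.symm) e.symm.surjective this

lemma lintegral_count (h : IsPoissonProcess P lam x) {D : Set Plane}
    (hD : MeasurableSet D) (hfin : volume D ≠ ∞) (hlam : 0 ≤ lam) :
    ∫⁻ ω, pointMeasure x ω D ∂P = ENNReal.ofReal lam * volume D := by
  have := (h.hasLaw_count D hD hfin).lintegral_comp (f := fun t => t) (by fun_prop)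
  rw [this, lintegral_poisson_id]
  change ENNReal.ofReal _ = _
  rw [ENNReal.ofReal_mul hlam, ENNReal.ofReal_toReal hfin]

lemma lintegral_pow_count (h : IsPoissonProcess P lam x) {D : Set Plane}
    (hD : MeasurableSet D) (hfin : volume D ≠ ∞) (hlam : 0 ≤ lam) {c : ℝ≥0∞} (hc : c ≤ 1) :
    ∫⁻ ω, (1 - c) ^ (pointMeasure x ω D).toReal ∂P =
      expNeg (ENNReal.ofReal lam * (c * volume D)) := by
  have := (h.hasLaw_count D hD hfin).lintegral_comp (f := fun t => (1 - c) ^ t.toReal)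
    (by fun_prop)
  rw [this, lintegral_poisson_pow _ hc]
  congr 1
  change ENNReal.ofReal _ * _ = _
  rw [ENNReal.ofReal_mul hlam, ENNReal.ofReal_toReal hfin]
  ring

lemma ae_count_ne_top (h : IsPoissonProcess P lam x) {D : Set Plane}
    (hD : MeasurableSet D) (hfin : volume D ≠ ∞) (hlam : 0 ≤ lam) :
    ∀ᵐ ω ∂P, pointMeasure x ω D ≠ ∞ := by
  refine (ae_lt_top (h.measurable_count hD) ?_).mono fun ω hω => hω.ne
  rw [h.lintegral_count hD hfin hlam]
  exact ENNReal.mul_ne_top ENNReal.ofReal_ne_top hfin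

/-- Mecke's formula in its elementary form. The set A is adjoined to the family as the extra index
`none`; being disjoint from the others, its count is independent of theirs and the expectation
factorizes. -/
lemma lintegral_count_mul_thinProd_stepFun (h : IsPoissonProcess P lam x) (hlam : 0 ≤ lam)
    {ι : Type*} [Fintype ι] {A : Set Plane} (hA : MeasurableSet A) (hAfin : volume A ≠ ∞)
    (D : ι → Set Plane) (hD : ∀ b, MeasurableSet (D b)) (hfin : ∀ b, volume (D b) ≠ ∞)
    (hdisj : Pairwise fun b b' => Disjoint (D b) (D b')) (hAD : ∀ b, Disjoint A (D b))
    (c : ι → ℝ≥0∞) (hc : ∀ b, c b ≤ 1) :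
    ∫⁻ ω, pointMeasure x ω A * thinProd (fun i => x i ω) ∅ (stepFun D c) ∂P =
      ENNReal.ofReal lam * volume A *
        expNeg (ENNReal.ofReal lam * ∫⁻ z, stepFun D c z) := by
  let D' : Option ι → Set Plane := fun o => o.elim A D
  have hind := h.iIndepFun_count_fintype D' (fun o => by cases o <;> simp [D', hA, hD])
    (fun o => by cases o <;> simp [D', hAfin, hfin]) (by
      rintro (_ | b) (_ | b') hne
      · exact absurd rfl hne
      · exact hAD b'
      · exact (hAD b).symm
      · exact hdisj fun h' => hne (by rw [h']))
  let g : Option ι → ℝ≥0∞ → ℝ≥0∞ := fun o => o.elim (fun t => t) fun b t => (1 - c b) ^ t.toReal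
  have hg : ∀ o, Measurable (g o) := by
    rintro (_ | b)
    · exact measurable_id
    · change Measurable fun t : ℝ≥0∞ => (1 - c b) ^ t.toReal
      fun_prop
  have hD' : ∀ o, MeasurableSet (D' o) := fun o => by cases o <;> simp [D', hA, hD]
  have hprod := lintegral_prod_eq_prod_lintegral_of_indepFun Finset.univ _
    (hind.comp g hg) (fun o => (hg o).comp (h.measurable_count (hD' o)))
  have hae : ∀ᵐ ω ∂P, ∀ b, pointMeasure x ω (D b) ≠ ∞ :=
    ae_all_iff.2 fun b => h.ae_count_ne_top (hD b) (hfin b) hlam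
  calc _ = ∫⁻ ω, ∏ o, (g o ∘ fun ω => pointMeasure x ω (D' o)) ω ∂P := by
        refine lintegral_congr_ae (hae.mono fun ω hω => ?_)
        dsimp only
        rw [thinProd_stepFun x ω D c hD hdisj hω, Fintype.prod_option]
        rfl
    _ = _ := by
        rw [hprod, Fintype.prod_option]
        congr 1
        · exact h.lintegral_count hA hAfin hlam
        · rw [lintegral_stepFun D c hD, Finset.mul_sum, expNeg_sum]
          · exact Finset.prod_congr rfl fun b _ =>
              h.lintegral_pow_count (hD b) (hfin b) hlam (hc b)
          · exact fun b _ => ENNReal.mul_ne_top ENNReal.ofReal_ne_top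
              (ENNReal.mul_ne_top (ne_top_of_le_ne_top ENNReal.one_ne_top (hc b)) (hfin b))

lemma lintegral_thinProd_stepFun (h : IsPoissonProcess P lam x) (hlam : 0 ≤ lam)
    {ι : Type*} [Fintype ι]
    (D : ι → Set Plane) (hD : ∀ b, MeasurableSet (D b)) (hfin : ∀ b, volume (D b) ≠ ∞)
    (hdisj : Pairwise fun b b' => Disjoint (D b) (D b'))
    (c : ι → ℝ≥0∞) (hc : ∀ b, c b ≤ 1) :
    ∫⁻ ω, thinProd (fun i => x i ω) ∅ (stepFun D c) ∂P =
      expNeg (ENNReal.ofReal lam * ∫⁻ z, stepFun D c z) := by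
  have hind := h.iIndepFun_count_fintype D hD hfin hdisj
  have hg : ∀ b, Measurable fun t : ℝ≥0∞ => (1 - c b) ^ t.toReal := fun b => by fun_prop
  have hprod := lintegral_prod_eq_prod_lintegral_of_indepFun Finset.univ _
    (hind.comp _ hg) (fun b => (hg b).comp (h.measurable_count (hD b)))
  have hae : ∀ᵐ ω ∂P, ∀ b, pointMeasure x ω (D b) ≠ ∞ :=
    ae_all_iff.2 fun b => h.ae_count_ne_top (hD b) (hfin b) hlam
  rw [lintegral_congr_ae (hae.mono fun ω hω => thinProd_stepFun x ω D c hD hdisj hω),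
    lintegral_stepFun D c hD, Finset.mul_sum, expNeg_sum]
  · exact hprod.trans (Finset.prod_congr rfl fun b _ =>
      h.lintegral_pow_count (hD b) (hfin b) hlam (hc b))
  · exact fun b _ => ENNReal.mul_ne_top ENNReal.ofReal_ne_top
      (ENNReal.mul_ne_top (ne_top_of_le_ne_top ENNReal.one_ne_top (hc b)) (hfin b))

end IsPoissonProcess

/-! ## Discretization along a countable basis -/

open Classical in
/-- The indices below `n` of the sets of the sequence `U` that contain `z`. -/
noncomputable def code (U : ℕ → Set Plane) (n : ℕ) (z : Plane) : Finset ℕ :=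
  (Finset.range n).filter fun m => z ∈ U m

lemma mem_code {U : ℕ → Set Plane} {n m : ℕ} {z : Plane} :
    m ∈ code U n z ↔ m < n ∧ z ∈ U m := by
  simp [code]

lemma code_mem_powerset (U : ℕ → Set Plane) (n : ℕ) (z : Plane) :
    code U n z ∈ (Finset.range n).powerset := by
  simp [code]

/-- The partitions into cells refine one another, the source of monotonicity in n. -/
lemma code_eq_of_le {U : ℕ → Set Plane} {m n : ℕ} (hmn : m ≤ n) {z w : Plane}
    (h : code U n z = code U n w) : code U m z = code U m w := by
  ext k
  have hk : k ∈ code U n z ↔ k ∈ code U n w := by rw [h]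
  simp only [mem_code] at hk ⊢
  constructor
  · rintro ⟨h1, h2⟩
    exact ⟨h1, (hk.1 ⟨by omega, h2⟩).2⟩
  · rintro ⟨h1, h2⟩
    exact ⟨h1, (hk.2 ⟨by omega, h2⟩).2⟩

lemma measurableSet_code {U : ℕ → Set Plane} (hU : ∀ m, MeasurableSet (U m)) (n : ℕ)
    (a : Finset ℕ) : MeasurableSet {z | code U n z = a} := by
  have : {z | code U n z = a} = ⋂ k, {z | (k < n ∧ z ∈ U k) ↔ k ∈ a} := by
    ext z
    simp only [Set.mem_ofPred_eq, Finset.ext_iff, mem_code, Set.mem_iInter]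
  rw [this]
  refine MeasurableSet.iInter fun k => ?_
  by_cases h1 : k < n <;> by_cases h2 : k ∈ a <;> simp only [h1, h2, true_and, false_and,
    iff_true, iff_false, Set.ofPred_mem_eq, MeasurableSet.const]
  · exact hU k
  · exact (hU k).compl

/-- The infimum (at most one) of `H` over the product of the cells with codes `a` and `b`. -/
noncomputable def cellInf (U : ℕ → Set Plane) (H : Plane → Plane → ℝ≥0∞) (n : ℕ)
    (a b : Finset ℕ) : ℝ≥0∞ :=
  min 1 (⨅ (u) (w) (_ : code U n u = a) (_ : code U n w = b), H u w)

/-- The part of the cell with code `b` in the ball of radius `n`, empty for `b = a`. -/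
def cell (U : ℕ → Set Plane) (n : ℕ) (a b : Finset ℕ) : Set Plane :=
  {z | code U n z = b ∧ b ≠ a} ∩ Metric.closedBall 0 n

/-- Lower approximation of `H x` for `x` in the cell with code `a`. -/
noncomputable def cellStep (U : ℕ → Set Plane) (H : Plane → Plane → ℝ≥0∞) (n : ℕ)
    (a : Finset ℕ) : Plane → ℝ≥0∞ :=
  stepFun (fun b : (Finset.range n).powerset => cell U n a b) fun b => cellInf U H n a b

variable {U : ℕ → Set Plane} {H : Plane → Plane → ℝ≥0∞}

lemma measurableSet_cell (hU : ∀ m, MeasurableSet (U m)) (n : ℕ) (a b : Finset ℕ) :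
    MeasurableSet (cell U n a b) := by
  refine MeasurableSet.inter ?_ Metric.isClosed_closedBall.measurableSet
  by_cases h : b = a <;> simp only [h, ne_eq, not_true_eq_false, not_false_eq_true, and_false,
    and_true, Set.ofPred_false, MeasurableSet.empty]
  exact measurableSet_code hU n b

lemma volume_cell_ne_top (n : ℕ) (a b : Finset ℕ) : volume (cell U n a b) ≠ ∞ :=
  ne_top_of_le_ne_top measure_closedBall_lt_top.ne (measure_mono Set.inter_subset_right)

lemma disjoint_cell (n : ℕ) (a : Finset ℕ) :
    Pairwise fun b b' : (Finset.range n).powerset => Disjoint (cell U n a b) (cell U n a b') := by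
  intro b b' hne
  refine Set.disjoint_left.2 fun z hz hz' => hne (Subtype.ext ?_)
  rw [← hz.1.1, ← hz'.1.1]

lemma cellInf_le_one (n : ℕ) (a b : Finset ℕ) : cellInf U H n a b ≤ 1 := min_le_left _ _

lemma cellInf_le (n : ℕ) (x z : Plane) : cellInf U H n (code U n x) (code U n z) ≤ H x z :=
  (min_le_right _ _).trans (iInf₂_le_of_le x z (iInf_le_of_le rfl (iInf_le _ rfl)))

lemma measurable_cellStep (hU : ∀ m, MeasurableSet (U m)) (n : ℕ) (a : Finset ℕ) :
    Measurable (cellStep U H n a) := by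
  unfold cellStep stepFun
  exact Finset.measurable_sum _ fun b _ =>
    measurable_const.indicator (measurableSet_cell hU n a b)

lemma cellStep_self (n : ℕ) (z : Plane) : cellStep U H n (code U n z) z = 0 := by
  unfold cellStep stepFun
  refine Finset.sum_eq_zero fun b _ => Set.indicator_of_notMem ?_ _
  rintro ⟨⟨h1, h2⟩, -⟩
  exact h2 h1.symm

lemma cellStep_code (hH : ∀ x, H x x = 0) (n : ℕ) (x z : Plane) :
    cellStep U H n (code U n x) z =
      if ‖z‖ ≤ n then cellInf U H n (code U n x) (code U n z) else 0 := by
  by_cases hxz : code U n z = code U n x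
  · rw [← hxz, cellStep_self, eq_comm, ite_eq_right_iff]
    intro _
    -- When z shares the cell of x, the infimum runs over the diagonal pair (z, z) and is 0 anyway,
    -- so removing that cell loses nothing.
    exact le_antisymm ((cellInf_le n z z).trans (hH z).le) zero_le
  unfold cellStep stepFun
  rw [Fintype.sum_eq_single ⟨code U n z, code_mem_powerset U n z⟩]
  · by_cases hz : ‖z‖ ≤ n <;> simp [Set.indicator, cell, hxz, hz]
  · intro b hb
    refine Set.indicator_of_notMem ?_ _
    rintro ⟨⟨h1, -⟩, -⟩
    exact hb (Subtype.ext h1.symm)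

lemma cellStep_le (hH : ∀ x, H x x = 0) (n : ℕ) (x z : Plane) :
    cellStep U H n (code U n x) z ≤ H x z := by
  rw [cellStep_code hH]
  split_ifs
  · exact cellInf_le n x z
  · exact zero_le

lemma monotone_cellStep (hH : ∀ x, H x x = 0) (x z : Plane) :
    Monotone fun n => cellStep U H n (code U n x) z := by
  intro m n hmn
  simp only [cellStep_code hH]
  by_cases hz : ‖z‖ ≤ m
  · rw [if_pos hz, if_pos (hz.trans (by exact_mod_cast hmn))]
    refine min_le_min le_rfl ?_
    refine le_iInf fun u => le_iInf fun w => le_iInf fun hu => le_iInf fun hw => ?_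
    exact iInf₂_le_of_le u w
      (iInf_le_of_le (code_eq_of_le hmn hu) (iInf_le _ (code_eq_of_le hmn hw)))
  · rw [if_neg hz]
    exact zero_le

/-- If H exceeds c' at (x, z), lower semicontinuity gives a product of basis sets U i × U j on which
it still does. Once n exceeds i and j, the cells of x and z lie inside these sets, so the infimum
over them is at least c'. -/
lemma tendsto_cellStep (hU : TopologicalSpace.IsTopologicalBasis (Set.range U))
    (hH : ∀ x, H x x = 0) (hH1 : ∀ x z, H x z ≤ 1)
    (hlsc : LowerSemicontinuous (Function.uncurry H)) (x z : Plane) :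
    Filter.Tendsto (fun n => cellStep U H n (code U n x) z) Filter.atTop (nhds (H x z)) := by
  have hsup : ⨆ n, cellStep U H n (code U n x) z = H x z := by
    refine le_antisymm (iSup_le fun n => cellStep_le hH n x z) (le_of_forall_lt fun c hc => ?_)
    obtain ⟨c', hcc', hc'⟩ := exists_between hc
    refine hcc'.trans_le ?_
    have h1 : ∀ᶠ q in nhds (x, z), c' < Function.uncurry H q := hlsc (x, z) c' hc'
    rw [nhds_prod_eq] at h1
    obtain ⟨s, hs, t, ht, hst⟩ := Filter.eventually_prod_iff.1 h1
    obtain ⟨_, ⟨i, rfl⟩, hi, his⟩ := hU.mem_nhds_iff.1 hs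
    obtain ⟨_, ⟨j, rfl⟩, hj, hjt⟩ := hU.mem_nhds_iff.1 ht
    obtain ⟨N, hN⟩ := exists_nat_ge ‖z‖
    refine le_iSup_of_le (max N (max (i + 1) (j + 1))) ?_
    set n := max N (max (i + 1) (j + 1)) with hn
    have hi' : i < n := by omega
    have hj' : j < n := by omega
    rw [cellStep_code hH, if_pos (hN.trans (by exact_mod_cast le_max_left _ _))]
    refine le_min (hc'.le.trans (hH1 x z)) ?_
    refine le_iInf fun u => le_iInf fun w => le_iInf fun hu => le_iInf fun hw => ?_
    refine (hst (his ?_) (hjt ?_)).le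
    · have : i ∈ code U n u := by rw [hu]; exact mem_code.2 ⟨hi', hi⟩
      exact (mem_code.1 this).2
    · have : j ∈ code U n w := by rw [hw]; exact mem_code.2 ⟨hj', hj⟩
      exact (mem_code.1 this).2
  rw [← hsup]
  exact tendsto_atTop_iSup (monotone_cellStep hH x z)

lemma comp_code_eq_sum (n : ℕ) (B : Set Plane) (f : Finset ℕ → ℝ≥0∞) (z : Plane) :
    B.indicator (fun z => f (code U n z)) z =
      ∑ a ∈ (Finset.range n).powerset,
        (B ∩ {z | code U n z = a}).indicator (fun _ => (1 : ℝ≥0∞)) z * f a := by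
  rw [Finset.sum_eq_single_of_mem _ (code_mem_powerset U n z)]
  · by_cases hz : z ∈ B <;> simp [Set.indicator, hz]
  · intro b _ hb
    rw [Set.indicator_of_notMem, zero_mul]
    rintro ⟨-, h⟩
    exact hb h.symm

lemma tendsto_thinProd {α : Type*} (x : ℕ → α) (E : Finset ℕ) (φ : ℕ → α → ℝ≥0∞)
    (ψ : α → ℝ≥0∞) (hmono : ∀ z, Monotone fun n => φ n z)
    (hlim : ∀ z, Filter.Tendsto (fun n => φ n z) Filter.atTop (nhds (ψ z))) :
    Filter.Tendsto (fun n => thinProd x E (φ n)) Filter.atTop (nhds (thinProd x E ψ)) := by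
  have hanti : ∀ k, Antitone fun n => ∏ j ∈ Finset.range k \ E, (1 - φ n (x j)) :=
    fun k m n hmn => Finset.prod_le_prod' fun j _ => tsub_le_tsub_left (hmono _ hmn) _
  have hinf : thinProd x E ψ = ⨅ n, thinProd x E (φ n) := by
    unfold thinProd
    -- The limits in the number of factors and in n are both infima, hence commute.
    rw [iInf_comm]
    refine iInf_congr fun k => ?_
    refine tendsto_nhds_unique ?_ (tendsto_atTop_iInf (hanti k))
    refine ENNReal.tendsto_finsetProd_of_ne_top _ (fun j _ => ?_) fun j _ => ?_
    · exact ENNReal.Tendsto.sub tendsto_const_nhds (hlim _) (Or.inl ENNReal.one_ne_top)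
    · exact ne_top_of_le_ne_top ENNReal.one_ne_top tsub_le_self
  rw [hinf]
  exact tendsto_atTop_iInf fun m n hmn => iInf_mono fun k => hanti k hmn

lemma tendsto_lintegral_cellStep (hU : TopologicalSpace.IsTopologicalBasis (Set.range U))
    (hH : ∀ x, H x x = 0) (hH1 : ∀ x z, H x z ≤ 1)
    (hlsc : LowerSemicontinuous (Function.uncurry H)) (x : Plane) :
    Filter.Tendsto (fun n => ∫⁻ z, cellStep U H n (code U n x) z) Filter.atTop
      (nhds (∫⁻ z, H x z)) :=
  lintegral_tendsto_of_tendsto_of_monotone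
    (fun n => (measurable_cellStep (fun m => (hU.isOpen ⟨m, rfl⟩).measurableSet) n _).aemeasurable)
    (Filter.Eventually.of_forall fun z => monotone_cellStep hH x z)
    (Filter.Eventually.of_forall fun z => tendsto_cellStep hU hH hH1 hlsc x z)

lemma exists_seq_isTopologicalBasis :
    ∃ U : ℕ → Set Plane, TopologicalSpace.IsTopologicalBasis (Set.range U) := by
  obtain ⟨b, hb, -, hbasis⟩ := TopologicalSpace.exists_countable_basis Plane
  obtain ⟨s, hs, -⟩ := hbasis.exists_subset_of_mem_open (Set.mem_univ (0 : Plane)) isOpen_univ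
  obtain ⟨U, rfl⟩ := hb.exists_eq_range ⟨s, hs⟩
  exact ⟨U, hbasis⟩

/-! ### Laplace functional and Mecke's formula -/

namespace IsPoissonProcess

variable {Ω : Type*} [MeasurableSpace Ω] {P : Measure Ω} {lam : ℝ} {x : ℕ → Ω → Plane}

lemma measurable_cellStep_comp (hU : ∀ m, MeasurableSet (U m)) (n : ℕ) {f : Ω → Plane}
    (hf : Measurable f) :
    Measurable (Function.uncurry fun ω z => cellStep U H n (code U n (f ω)) z) := by
  have : (Function.uncurry fun ω z => cellStep U H n (code U n (f ω)) z) =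
      fun q : Ω × Plane => ∑ a ∈ (Finset.range n).powerset,
        {z | code U n z = a}.indicator (fun _ => (1 : ℝ≥0∞)) (f q.1) * cellStep U H n a q.2 := by
    ext ⟨ω, z⟩
    have := comp_code_eq_sum (U := U) n Set.univ (fun a => cellStep U H n a z) (f ω)
    simpa using this
  rw [this]
  refine Finset.measurable_sum _ fun a _ => Measurable.mul ?_ ?_
  · exact (measurable_const.indicator (measurableSet_code hU n a)).comp (hf.comp measurable_fst)
  · exact (measurable_cellStep hU n a).comp measurable_snd

/-- The distinguished point enters the step function only through its code. Splitting B by codes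
reduces the claim to finitely many cells, on each of which the elementary formula applies. -/
lemma tsum_lintegral_cellStep (h : IsPoissonProcess P lam x) (hlam : 0 ≤ lam)
    (hU : ∀ m, MeasurableSet (U m)) {B : Set Plane}
    (hB : MeasurableSet B) (hBfin : volume B ≠ ∞) (n : ℕ) :
    ∑' i, ∫⁻ ω, B.indicator (fun _ => 1) (x i ω) *
        thinProd (fun j => x j ω) {i} (cellStep U H n (code U n (x i ω))) ∂P =
      ∫⁻ u in B, ENNReal.ofReal lam *
        expNeg (ENNReal.ofReal lam * ∫⁻ z, cellStep U H n (code U n u) z) := by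
  set S := (Finset.range n).powerset
  have hBa : ∀ a, MeasurableSet (B ∩ {z | code U n z = a}) :=
    fun a => hB.inter (measurableSet_code hU n a)
  have hT : ∀ a, Measurable fun ω => thinProd (fun j => x j ω) ∅ (cellStep U H n a) := fun a =>
    measurable_thinProd h.measurable ∅ (φ := fun _ => cellStep U H n a)
      ((measurable_cellStep hU n a).comp measurable_snd)
  have hm : ∀ i, Measurable fun ω => B.indicator (fun _ => (1 : ℝ≥0∞)) (x i ω) *
      thinProd (fun j => x j ω) {i} (cellStep U H n (code U n (x i ω))) := fun i =>
    ((measurable_const.indicator hB).comp (h.measurable i)).mul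
      (measurable_thinProd h.measurable {i} (measurable_cellStep_comp hU n (h.measurable i)))
  have h1 : ∀ ω i, B.indicator (fun _ => (1 : ℝ≥0∞)) (x i ω) *
      thinProd (fun j => x j ω) {i} (cellStep U H n (code U n (x i ω))) =
      ∑ a ∈ S, (B ∩ {z | code U n z = a}).indicator (fun _ => (1 : ℝ≥0∞)) (x i ω) *
        thinProd (fun j => x j ω) ∅ (cellStep U H n a) := by
    intro ω i
    -- The step function vanishes on the point's own cell, so index i can be restored and the
    -- product depends only on the cell a.
    rw [thinProd_eq_empty _ _ _ (by simp [cellStep_self]),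
      ← comp_code_eq_sum n B (fun a => thinProd (fun j => x j ω) ∅ (cellStep U H n a))]
    by_cases hz : x i ω ∈ B <;> simp [hz]
  rw [← lintegral_tsum fun i => (hm i).aemeasurable]
  have h2 : ∀ ω, ∑' i, B.indicator (fun _ => (1 : ℝ≥0∞)) (x i ω) *
      thinProd (fun j => x j ω) {i} (cellStep U H n (code U n (x i ω))) =
      ∑ a ∈ S, pointMeasure x ω (B ∩ {z | code U n z = a}) *
        thinProd (fun j => x j ω) ∅ (cellStep U H n a) := by
    intro ω
    simp_rw [h1]
    rw [Summable.tsum_finsetSum fun a _ => ENNReal.summable]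
    refine Finset.sum_congr rfl fun a _ => ?_
    rw [ENNReal.tsum_mul_right, pointMeasure_apply x ω (hBa a)]
  simp_rw [h2]
  have h4 : ∀ a ∈ S, Measurable fun ω => pointMeasure x ω (B ∩ {z | code U n z = a}) *
      thinProd (fun j => x j ω) ∅ (cellStep U H n a) :=
    fun a _ => (h.measurable_count (hBa a)).mul (hT a)
  rw [lintegral_finsetSum S h4, ← lintegral_indicator hB]
  have h3 := comp_code_eq_sum (U := U) n B fun a => ENNReal.ofReal lam *
    expNeg (ENNReal.ofReal lam * ∫⁻ z, cellStep U H n a z)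
  simp_rw [h3]
  have h5 : ∀ a ∈ S, Measurable fun z => (B ∩ {z | code U n z = a}).indicator
      (fun _ => (1 : ℝ≥0∞)) z * (ENNReal.ofReal lam *
        expNeg (ENNReal.ofReal lam * ∫⁻ z, cellStep U H n a z)) :=
    fun a _ => (measurable_const.indicator (hBa a)).mul measurable_const
  rw [lintegral_finsetSum S h5]
  refine Finset.sum_congr rfl fun a _ => ?_
  have hfin : volume (B ∩ {z | code U n z = a}) ≠ ∞ :=
    ne_top_of_le_ne_top hBfin (measure_mono Set.inter_subset_left)
  rw [lintegral_mul_const _ (measurable_const.indicator (hBa a)),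
    lintegral_indicator_const (hBa a), one_mul]
  unfold cellStep
  rw [h.lintegral_count_mul_thinProd_stepFun hlam (hBa a) hfin
    (fun b : (Finset.range n).powerset => cell U n a b)
    (fun b => measurableSet_cell hU n a b) (fun b => volume_cell_ne_top n a b) (disjoint_cell n a)
    (fun b => ?_) _ fun b => cellInf_le_one n a b]
  · ring
  · refine Set.disjoint_left.2 fun z hz hz' => hz'.1.2 ?_
    rw [← hz'.1.1]
    exact hz.2

lemma lintegral_thinProd_cellStep (h : IsPoissonProcess P lam x) (hlam : 0 ≤ lam)
    (hU : ∀ m, MeasurableSet (U m)) (n : ℕ) (a : Finset ℕ) :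
    ∫⁻ ω, thinProd (fun j => x j ω) ∅ (cellStep U H n a) ∂P =
      expNeg (ENNReal.ofReal lam * ∫⁻ z, cellStep U H n a z) := by
  unfold cellStep
  exact h.lintegral_thinProd_stepFun hlam (fun b : (Finset.range n).powerset => cell U n a b)
    (fun b => measurableSet_cell hU n a b) (fun b => volume_cell_ne_top n a b)
    (disjoint_cell n a) _ fun b => cellInf_le_one n a b

/-- The Laplace functional of a Poisson process. -/
theorem lintegral_thinProd (h : IsPoissonProcess P lam x) (hlam : 0 ≤ lam)
    (hH : ∀ x, H x x = 0) (hH1 : ∀ x z, H x z ≤ 1)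
    (hlsc : LowerSemicontinuous (Function.uncurry H)) (u : Plane) (hfin : ∫⁻ z, H u z ≠ ∞)
    [IsProbabilityMeasure P] :
    ∫⁻ ω, thinProd (fun j => x j ω) ∅ (H u) ∂P =
      expNeg (ENNReal.ofReal lam * ∫⁻ z, H u z) := by
  obtain ⟨U, hU⟩ := exists_seq_isTopologicalBasis
  have hUm : ∀ m, MeasurableSet (U m) := fun m => (hU.isOpen ⟨m, rfl⟩).measurableSet
  have hstep : ∀ n, ∫⁻ ω, thinProd (fun j => x j ω) ∅ (cellStep U H n (code U n u)) ∂P =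
      expNeg (ENNReal.ofReal lam * ∫⁻ z, cellStep U H n (code U n u) z) := fun n =>
    h.lintegral_thinProd_cellStep hlam hUm n _
  have hR : Filter.Tendsto
      (fun n => expNeg (ENNReal.ofReal lam * ∫⁻ z, cellStep U H n (code U n u) z))
      Filter.atTop (nhds (expNeg (ENNReal.ofReal lam * ∫⁻ z, H u z))) :=
    tendsto_expNeg (ENNReal.mul_ne_top ENNReal.ofReal_ne_top hfin)
      (ENNReal.Tendsto.const_mul (tendsto_lintegral_cellStep hU hH hH1 hlsc u)
        (Or.inr ENNReal.ofReal_ne_top))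
  have hL : Filter.Tendsto
      (fun n => ∫⁻ ω, thinProd (fun j => x j ω) ∅ (cellStep U H n (code U n u)) ∂P)
      Filter.atTop (nhds (∫⁻ ω, thinProd (fun j => x j ω) ∅ (H u) ∂P)) := by
    refine tendsto_lintegral_of_dominated_convergence (fun _ => 1) (fun n => ?_) (fun n => ?_)
      (by simp) ?_
    · exact measurable_thinProd h.measurable ∅ (φ := fun _ => cellStep U H n _)
        ((measurable_cellStep hUm n _).comp measurable_snd)
    · exact Filter.Eventually.of_forall fun ω => thinProd_le_one _ _ _
    · exact Filter.Eventually.of_forall fun ω => tendsto_thinProd _ _ _ _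
        (fun z => monotone_cellStep hH u z) fun z => tendsto_cellStep hU hH hH1 hlsc u z
  simp_rw [hstep] at hL
  exact tendsto_nhds_unique hL hR

/-- Mecke's formula for the probability that no other point is retained. -/
theorem tsum_lintegral_thinProd (h : IsPoissonProcess P lam x) (hlam : 0 ≤ lam)
    (hH : ∀ x, H x x = 0) (hH1 : ∀ x z, H x z ≤ 1)
    (hlsc : LowerSemicontinuous (Function.uncurry H)) (hfin : ∀ u, ∫⁻ z, H u z ≠ ∞)
    {B : Set Plane} (hB : MeasurableSet B) (hBfin : volume B ≠ ∞) :
    ∑' i, ∫⁻ ω, B.indicator (fun _ => 1) (x i ω) *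
        thinProd (fun j => x j ω) {i} (H (x i ω)) ∂P =
      ∫⁻ u in B, ENNReal.ofReal lam * expNeg (ENNReal.ofReal lam * ∫⁻ z, H u z) := by
  obtain ⟨U, hU⟩ := exists_seq_isTopologicalBasis
  have hUm : ∀ m, MeasurableSet (U m) := fun m => (hU.isOpen ⟨m, rfl⟩).measurableSet
  have hind : ∀ i, Measurable fun ω => B.indicator (fun _ => (1 : ℝ≥0∞)) (x i ω) := fun i =>
    (measurable_const.indicator hB).comp (h.measurable i)
  have hle : ∀ i ω (φ : Plane → ℝ≥0∞), B.indicator (fun _ => (1 : ℝ≥0∞)) (x i ω) *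
      thinProd (fun j => x j ω) {i} φ ≤ B.indicator (fun _ => 1) (x i ω) := fun i ω φ =>
    mul_le_of_le_one_right' (thinProd_le_one _ _ _)
  -- The dominating series is the mean number of points in B.
  have htot : ∑' i, ∫⁻ ω, B.indicator (fun _ => (1 : ℝ≥0∞)) (x i ω) ∂P ≠ ∞ := by
    rw [← lintegral_tsum fun i => (hind i).aemeasurable]
    simp_rw [← pointMeasure_apply x _ hB]
    rw [h.lintegral_count hB hBfin hlam]
    exact ENNReal.mul_ne_top ENNReal.ofReal_ne_top hBfin
  have hR : Filter.Tendsto (fun n => ∫⁻ u in B, ENNReal.ofReal lam *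
        expNeg (ENNReal.ofReal lam * ∫⁻ z, cellStep U H n (code U n u) z)) Filter.atTop
      (nhds (∫⁻ u in B, ENNReal.ofReal lam * expNeg (ENNReal.ofReal lam * ∫⁻ z, H u z))) := by
    refine tendsto_lintegral_of_dominated_convergence (fun _ => ENNReal.ofReal lam)
      (fun n => ?_) (fun n => ?_) ?_ ?_
    · refine (measurable_expNeg.comp ((Measurable.lintegral_prod_right ?_).const_mul _)).const_mul _
      exact measurable_cellStep_comp hUm n measurable_id
    · exact Filter.Eventually.of_forall fun u => mul_le_of_le_one_right' (expNeg_le_one _)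
    · simpa using ENNReal.mul_ne_top ENNReal.ofReal_ne_top hBfin
    · refine Filter.Eventually.of_forall fun u => ?_
      exact ENNReal.Tendsto.const_mul
        (tendsto_expNeg (ENNReal.mul_ne_top ENNReal.ofReal_ne_top (hfin u))
          (ENNReal.Tendsto.const_mul (tendsto_lintegral_cellStep hU hH hH1 hlsc u)
            (Or.inr ENNReal.ofReal_ne_top))) (Or.inr ENNReal.ofReal_ne_top)
  have hLi : ∀ i, Filter.Tendsto (fun n => ∫⁻ ω, B.indicator (fun _ => 1) (x i ω) *
        thinProd (fun j => x j ω) {i} (cellStep U H n (code U n (x i ω))) ∂P) Filter.atTop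
      (nhds (∫⁻ ω, B.indicator (fun _ => 1) (x i ω) *
        thinProd (fun j => x j ω) {i} (H (x i ω)) ∂P)) := by
    intro i
    refine tendsto_lintegral_of_dominated_convergence
      (fun ω => B.indicator (fun _ => (1 : ℝ≥0∞)) (x i ω))
      (fun n => ?_) (fun n => Filter.Eventually.of_forall fun ω => hle i ω _)
      (ENNReal.ne_top_of_tsum_ne_top htot i) (Filter.Eventually.of_forall fun ω => ?_)
    · exact (hind i).mul
        (measurable_thinProd h.measurable {i} (measurable_cellStep_comp hUm n (h.measurable i)))
    · refine ENNReal.Tendsto.const_mul (tendsto_thinProd _ _ _ _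
        (fun z => monotone_cellStep hH _ z) fun z => tendsto_cellStep hU hH hH1 hlsc _ z)
        (Or.inr ?_)
      by_cases hz : x i ω ∈ B <;> simp [hz]
  have hL : Filter.Tendsto (fun n => ∑' i, ∫⁻ ω, B.indicator (fun _ => 1) (x i ω) *
        thinProd (fun j => x j ω) {i} (cellStep U H n (code U n (x i ω))) ∂P) Filter.atTop
      (nhds (∑' i, ∫⁻ ω, B.indicator (fun _ => 1) (x i ω) *
        thinProd (fun j => x j ω) {i} (H (x i ω)) ∂P)) := by
    -- The series is an integral against counting measure on ℕ, so dominated convergence applies to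
    -- it too.
    simp_rw [← MeasureTheory.lintegral_count]
    refine tendsto_lintegral_of_dominated_convergence
      (fun i => ∫⁻ ω, B.indicator (fun _ => (1 : ℝ≥0∞)) (x i ω) ∂P)
      (fun n => .of_discrete)
      (fun n => Filter.Eventually.of_forall fun i => lintegral_mono fun ω => hle i ω _)
      (by rwa [MeasureTheory.lintegral_count]) (Filter.Eventually.of_forall hLi)
  simp_rw [h.tsum_lintegral_cellStep hlam hUm hB hBfin] at hL
  exact tendsto_nhds_unique hL hR

end IsPoissonProcess

/-! ## Independent marks -/

section Marks

variable {Ω : Type*} [MeasurableSpace Ω] {P : Measure Ω} [IsProbabilityMeasure P]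

/-- Freezing one of two independent variables: the joint law is a product, so Tonelli applies. It
serves to condition on locations and on timers. -/
lemma lintegral_comp_of_indepFun {α β : Type*} [MeasurableSpace α] [MeasurableSpace β]
    {X : Ω → α} {Y : Ω → β} (h : IndepFun X Y P) (hX : Measurable X) (hY : Measurable Y)
    {f : α × β → ℝ≥0∞} (hf : Measurable f) :
    ∫⁻ ω, f (X ω, Y ω) ∂P = ∫⁻ ω, ∫⁻ ω', f (X ω, Y ω') ∂P ∂P := by
  have : IsProbabilityMeasure (P.map Y) := Measure.isProbabilityMeasure_map hY.aemeasurable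
  rw [← lintegral_map (f := f) (g := fun ω => (X ω, Y ω)) hf (hX.prodMk hY),
    h.map_prod_eq_prod_map_map hX.aemeasurable hY.aemeasurable, lintegral_prod _ hf.aemeasurable,
    lintegral_map hf.lintegral_prod_right' hX]
  refine lintegral_congr fun ω => ?_
  exact lintegral_map (hf.comp measurable_prodMk_left) hY

lemma measure_preimage_of_indepFun {α β : Type*} [MeasurableSpace α] [MeasurableSpace β]
    {X : Ω → α} {Y : Ω → β} (h : IndepFun X Y P) (hX : Measurable X) (hY : Measurable Y)
    {A : Set (α × β)} (hA : MeasurableSet A) :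
    P {ω | (X ω, Y ω) ∈ A} = ∫⁻ ω, P {ω' | (X ω, Y ω') ∈ A} ∂P := by
  have := lintegral_comp_of_indepFun h hX hY (f := A.indicator 1) (measurable_one.indicator hA)
  refine (lintegral_indicator_one ((hX.prodMk hY) hA)).symm.trans
    (this.trans (lintegral_congr fun ω => ?_))
  exact lintegral_indicator_one ((measurable_const.prodMk hY) hA)

variable {κ ι : Type*} {X : κ → Ω → ℝ} {t g : ι → κ}

lemma measure_le_or_mem (hX : iIndepFun X P) (hXm : ∀ m, Measurable (X m)) {m m' : κ}
    (hne : m ≠ m') (s : ℝ) {θ : Set ℝ} (hθ : MeasurableSet θ) :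
    P {ω | s ≤ X m ω ∨ X m' ω ∈ θ} = 1 - P {ω | X m ω < s} * P {ω | X m' ω ∉ θ} := by
  have h1 := (hX.indepFun hne).measure_inter_preimage_eq_mul (Set.Iio s) θᶜ
    measurableSet_Iio hθ.compl
  have hm : MeasurableSet (X m ⁻¹' Set.Iio s ∩ X m' ⁻¹' θᶜ) :=
    (hXm m measurableSet_Iio).inter (hXm m' hθ.compl)
  have h2 : {ω | s ≤ X m ω ∨ X m' ω ∈ θ} = (X m ⁻¹' Set.Iio s ∩ X m' ⁻¹' θᶜ)ᶜ := by
    ext ω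
    simp only [Set.mem_ofPred_eq, Set.mem_compl_iff, Set.mem_inter_iff, Set.mem_preimage,
      Set.mem_Iio]
    rw [not_and_or, not_lt, not_not]
  rw [h2, prob_compl_eq_one_sub hm, h1]
  rfl

/-- With the threshold s deterministic, the events for different j involve disjoint pairs of marks
and are independent; induction splits off one pair at a time. -/
lemma measure_forall_le_or_mem (hX : iIndepFun X P) (hXm : ∀ m, Measurable (X m))
    (ht : Function.Injective t) (hg : Function.Injective g) (htg : ∀ i j, t i ≠ g j)
    (s : ℝ) {θ : ι → Set ℝ} (hθ : ∀ j, MeasurableSet (θ j)) (F : Finset ι) :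
    P {ω | ∀ j ∈ F, s ≤ X (t j) ω ∨ X (g j) ω ∈ θ j} =
      ∏ j ∈ F, (1 - P {ω | X (t j) ω < s} * P {ω | X (g j) ω ∉ θ j}) := by
  classical
  induction F using Finset.induction_on with
  | empty => simp
  | insert a F ha ih =>
    rw [Finset.prod_insert ha, ← ih, ← measure_le_or_mem hX hXm (htg a a) s (hθ a)]
    let K : Finset κ := {t a, g a}
    let K' : Finset κ := F.image t ∪ F.image g
    have hK : Disjoint K K' := by
      rw [Finset.disjoint_left]
      intro m hm hm'
      simp only [K, K', Finset.mem_insert, Finset.mem_singleton, Finset.mem_union,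
        Finset.mem_image] at hm hm'
      rcases hm with rfl | rfl <;> rcases hm' with ⟨j, hj, hj'⟩ | ⟨j, hj, hj'⟩
      · exact ha (ht hj' ▸ hj)
      · exact htg a j hj'.symm
      · exact htg j a hj'
      · exact ha (hg hj' ▸ hj)
    have hmt : ∀ j ∈ F, t j ∈ K' := fun j hj =>
      Finset.mem_union_left _ (Finset.mem_image_of_mem t hj)
    have hmg : ∀ j ∈ F, g j ∈ K' := fun j hj =>
      Finset.mem_union_right _ (Finset.mem_image_of_mem g hj)
    have hind := hX.indepFun_finset K K' hK hXm
    have h1 : MeasurableSet {v : K → ℝ | s ≤ v ⟨t a, by simp [K]⟩ ∨ v ⟨g a, by simp [K]⟩ ∈ θ a} :=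
      (measurableSet_le measurable_const (measurable_pi_apply _)).union
        (measurable_pi_apply _ (hθ a))
    have h2 : MeasurableSet {v : K' → ℝ | ∀ j (hj : j ∈ F), s ≤ v ⟨t j, hmt j hj⟩ ∨
        v ⟨g j, hmg j hj⟩ ∈ θ j} := by
      have : {v : K' → ℝ | ∀ j (hj : j ∈ F), s ≤ v ⟨t j, hmt j hj⟩ ∨ v ⟨g j, hmg j hj⟩ ∈ θ j} =
          ⋂ j : F, ({v | s ≤ v ⟨t j, hmt j j.2⟩} ∪ {v | v ⟨g j, hmg j j.2⟩ ∈ θ j}) := by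
        ext v
        simp
      rw [this]
      exact MeasurableSet.iInter fun j =>
        (measurableSet_le measurable_const (measurable_pi_apply _)).union
          (measurable_pi_apply _ (hθ j))
    have h3 := hind.measure_inter_preimage_eq_mul _ _ h1 h2
    refine Eq.trans (congrArg P ?_) h3
    ext ω
    simp

/-- The events share the timer X u, so they are independent only conditionally on it; it is frozen
first. -/
lemma measure_forall_timer_le_or_mem (hX : iIndepFun X P) (hXm : ∀ m, Measurable (X m))
    (ht : Function.Injective t) (hg : Function.Injective g) (htg : ∀ i j, t i ≠ g j)
    {θ : ι → Set ℝ} (hθ : ∀ j, MeasurableSet (θ j)) (F : Finset ι) {u : κ}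
    (hu : ∀ j ∈ F, t j ≠ u) (hu' : ∀ j, g j ≠ u) :
    P {ω | ∀ j ∈ F, X u ω ≤ X (t j) ω ∨ X (g j) ω ∈ θ j} =
      ∫⁻ ω', ∏ j ∈ F, (1 - P {ω | X (t j) ω < X u ω'} * P {ω | X (g j) ω ∉ θ j}) ∂P := by
  classical
  let K' : Finset κ := F.image t ∪ F.image g
  have hK : Disjoint {u} K' := by
    rw [Finset.disjoint_left]
    intro m hm hm'
    simp only [K', Finset.mem_singleton, Finset.mem_union, Finset.mem_image] at hm hm'
    subst hm
    rcases hm' with ⟨j, hj, hj'⟩ | ⟨j, hj, hj'⟩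
    · exact hu j hj hj'
    · exact hu' j hj'
  have hmt : ∀ j ∈ F, t j ∈ K' := fun j hj =>
    Finset.mem_union_left _ (Finset.mem_image_of_mem t hj)
  have hmg : ∀ j ∈ F, g j ∈ K' := fun j hj =>
    Finset.mem_union_right _ (Finset.mem_image_of_mem g hj)
  have hind : IndepFun (X u) (fun ω (m : K') => X m ω) P :=
    (hX.indepFun_finset {u} K' hK hXm).comp
      (φ := fun v : (({u} : Finset κ) → ℝ) => v ⟨u, by simp⟩) (ψ := id)
      (measurable_pi_apply _) measurable_id
  let A : Set (ℝ × (K' → ℝ)) := ⋂ j : F, ({q | q.1 ≤ q.2 ⟨t j, hmt j j.2⟩} ∪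
    {q | q.2 ⟨g j, hmg j j.2⟩ ∈ θ j})
  have hev : ∀ m : K', Measurable fun q : ℝ × (K' → ℝ) => q.2 m := fun m => by fun_prop
  have hA : MeasurableSet A := MeasurableSet.iInter fun j =>
    (measurableSet_le measurable_fst (hev _)).union (hev _ (hθ j))
  have h1 := measure_preimage_of_indepFun hind (hXm u)
    (measurable_pi_lambda _ fun m : K' => hXm m) hA
  have hmem : ∀ s ω, (s, fun m : K' => X m ω) ∈ A ↔
      ∀ j ∈ F, s ≤ X (t j) ω ∨ X (g j) ω ∈ θ j := by
    intro s ω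
    simp [A]
  simp_rw [hmem] at h1
  rw [h1]
  exact lintegral_congr fun ω' => measure_forall_le_or_mem hX hXm ht hg htg _ hθ F

lemma measure_inter_forall_timer_le_or_mem {α : Type*} [MeasurableSpace α] {L : Ω → α}
    (hL : Measurable L) (hX : iIndepFun X P) (hXm : ∀ m, Measurable (X m))
    (hLX : IndepFun L (fun ω m => X m ω) P)
    (ht : Function.Injective t) (hg : Function.Injective g) (htg : ∀ i j, t i ≠ g j)
    {θ : ι → Set (α × ℝ)} (hθ : ∀ j, MeasurableSet (θ j)) (F : Finset ι) {u : κ}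
    (hu : ∀ j ∈ F, t j ≠ u) (hu' : ∀ j, g j ≠ u) {W : Set α} (hW : MeasurableSet W) :
    P ({ω | L ω ∈ W} ∩ {ω | ∀ j ∈ F, X u ω ≤ X (t j) ω ∨ (L ω, X (g j) ω) ∈ θ j}) =
      ∫⁻ ω, W.indicator (fun _ => 1) (L ω) * ∫⁻ ω', ∏ j ∈ F, (1 - P {ω'' | X (t j) ω'' < X u ω'} *
        P {ω'' | (L ω, X (g j) ω'') ∉ θ j}) ∂P ∂P := by
  let A : Set (α × (κ → ℝ)) := {q | q.1 ∈ W} ∩ ⋂ j : F, ({q | q.2 u ≤ q.2 (t j)} ∪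
    {q | (q.1, q.2 (g j)) ∈ θ j})
  have hev : ∀ m, Measurable fun q : α × (κ → ℝ) => q.2 m := fun m => by fun_prop
  have hA : MeasurableSet A := by
    refine (measurable_fst hW).inter (MeasurableSet.iInter fun j => ?_)
    exact (measurableSet_le (hev _) (hev _)).union ((measurable_fst.prodMk (hev _)) (hθ j))
  have h1 := measure_preimage_of_indepFun hLX hL (measurable_pi_lambda _ hXm) hA
  have hmem : ∀ l ω, (l, fun m => X m ω) ∈ A ↔
      l ∈ W ∧ ∀ j ∈ F, X u ω ≤ X (t j) ω ∨ (l, X (g j) ω) ∈ θ j := by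
    intro l ω
    simp [A]
  simp_rw [hmem] at h1
  refine Eq.trans h1 (lintegral_congr fun ω => ?_)
  by_cases hω : L ω ∈ W
  · simp only [hω, true_and, Set.indicator_of_mem, one_mul]
    exact measure_forall_timer_le_or_mem (θ := fun j => {r | (L ω, r) ∈ θ j}) hX hXm ht hg htg
      (fun j => measurable_prodMk_left (hθ j)) F hu hu'
  · simp [hω]

end Marks

/-! ## Detection probabilities -/

lemma expMeasure_Ioi {r : ℝ} (hr : 0 < r) {x : ℝ} (hx : 0 ≤ x) :
    expMeasure r (Set.Ioi x) = ENNReal.ofReal (Real.exp (-(r * x))) := by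
  have : IsProbabilityMeasure (expMeasure r) := isProbabilityMeasure_expMeasure hr
  have h1 := cdf_expMeasure_eq hr x
  rw [cdf_eq_real, if_pos hx] at h1
  have h2 : (expMeasure r).real (Set.Ioi x) = Real.exp (-(r * x)) := by
    rw [← Set.compl_Iic, probReal_compl_eq_one_sub measurableSet_Iic, h1]
    ring
  rw [← h2, ofReal_measureReal]

namespace Params

variable (p : Params)

lemma pathLoss_nonneg {d : ℝ} (hd : 0 ≤ d) : 0 ≤ p.pathLoss d :=
  mul_nonneg (sq_nonneg _) (Real.rpow_nonneg hd _)

lemma pathLoss_coeff_pos : 0 < (4 * Real.pi / p.wavelength) ^ 2 := by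
  have := p.wavelength_pos
  positivity

lemma pathLoss_eq_zero_iff {d : ℝ} (hd : 0 ≤ d) : p.pathLoss d = 0 ↔ d = 0 := by
  rw [pathLoss, mul_eq_zero, Real.rpow_eq_zero hd p.alpha_pos.ne',
    or_iff_right p.pathLoss_coeff_pos.ne']

lemma continuous_pathLoss : Continuous p.pathLoss := by
  unfold pathLoss
  exact continuous_const.mul (Real.continuous_rpow_const p.alpha_pos.le)

open Classical in
/-- Probability that a transmission from `z` is received at `x` with relative power above `c`. -/
noncomputable def detect (c : ℝ) (x z : Plane) : ℝ≥0∞ :=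
  if z = x then 0 else ENNReal.ofReal (Real.exp (-(p.mu * c * p.pathLoss ‖z - x‖)))

/-- Integral of the detection probability over the plane. -/
noncomputable def detectIntegral (c : ℝ) : ℝ≥0∞ :=
  ∫⁻ z : Plane, ENNReal.ofReal (Real.exp (-(p.mu * c * p.pathLoss ‖z‖)))

/-- At z = x the path loss is 0 and the quotient takes the default value 0 ≤ c. Detection then has
probability 0, which is why `detect` vanishes on the diagonal. -/
lemma expMeasure_detect {c : ℝ} (hc : 0 < c) (x z : Plane) :
    expMeasure p.mu {r | ¬ r / p.pathLoss ‖z - x‖ ≤ c} = p.detect c x z := by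
  have h0 := p.pathLoss_eq_zero_iff (norm_nonneg (z - x))
  have hnn := p.pathLoss_nonneg (norm_nonneg (z - x))
  unfold detect
  split_ifs with hzx
  · rw [h0.2 (by simp [hzx])]
    simp [hc.le]
  · have hpos : 0 < p.pathLoss ‖z - x‖ := by
      refine lt_of_le_of_ne hnn fun h => hzx ?_
      exact sub_eq_zero.1 (norm_eq_zero.1 (h0.1 h.symm))
    have : {r : ℝ | ¬ r / p.pathLoss ‖z - x‖ ≤ c} = Set.Ioi (c * p.pathLoss ‖z - x‖) := by
      ext r
      simp only [Set.mem_ofPred_eq, not_le, Set.mem_Ioi, lt_div_iff₀ hpos]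
    rw [this, expMeasure_Ioi p.mu_pos (by positivity), mul_assoc]

lemma detect_self (c : ℝ) (x : Plane) : p.detect c x x = 0 := by simp [detect]

lemma detect_le_one {c : ℝ} (hc : 0 < c) (x z : Plane) : p.detect c x z ≤ 1 := by
  have : IsProbabilityMeasure (expMeasure p.mu) := isProbabilityMeasure_expMeasure p.mu_pos
  rw [← p.expMeasure_detect hc]
  exact prob_le_one

/-- A nonnegative continuous function lowered to 0 on the closed diagonal stays lower
semicontinuous. -/
lemma lowerSemicontinuous_mul_detect {a : ℝ≥0∞} (ha : a ≠ ∞) (c : ℝ) :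
    LowerSemicontinuous (Function.uncurry fun x z => a * p.detect c x z) := by
  have hcont : Continuous fun q : Plane × Plane =>
      a * ENNReal.ofReal (Real.exp (-(p.mu * c * p.pathLoss ‖q.2 - q.1‖))) := by
    refine (ENNReal.continuous_const_mul ha).comp (ENNReal.continuous_ofReal.comp ?_)
    have := p.continuous_pathLoss
    fun_prop
  intro q y hy
  by_cases hq : q.2 = q.1
  · simp [Function.uncurry, detect, hq] at hy
  have h1 : ∀ᶠ q' in nhds q, q'.2 ≠ q'.1 :=
    (isOpen_ne_fun continuous_snd continuous_fst).mem_nhds hq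
  have h2 := (hcont.tendsto q).eventually_const_lt (u := y) (by
    simpa [Function.uncurry, detect, hq] using hy)
  filter_upwards [h1, h2] with q' hq' hy'
  simpa [Function.uncurry, detect, hq'] using hy'

lemma measurable_detect (c : ℝ) : Measurable (Function.uncurry (p.detect c)) := by
  have := (p.lowerSemicontinuous_mul_detect ENNReal.one_ne_top c).measurable
  simpa using this

/-- The point x is null and Lebesgue measure is translation invariant. Independence of x is what
makes the Palm ratio independent of the window. -/
lemma lintegral_detect (c : ℝ) (x : Plane) : ∫⁻ z, p.detect c x z = p.detectIntegral c := by
  have h1 : ∀ᵐ z : Plane, p.detect c x z =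
      ENNReal.ofReal (Real.exp (-(p.mu * c * p.pathLoss ‖z - x‖))) := by
    filter_upwards [compl_mem_ae_iff.2 (measure_singleton x)] with z hz
    exact if_neg hz
  rw [lintegral_congr_ae h1, detectIntegral]
  exact lintegral_sub_right_eq_self
    (fun z : Plane => ENNReal.ofReal (Real.exp (-(p.mu * c * p.pathLoss ‖z‖)))) x

lemma integrable_detect {c : ℝ} (hc : 0 < c) :
    Integrable fun z : Plane => Real.exp (-(p.mu * c * p.pathLoss ‖z‖)) := by
  rw [integrable_fun_norm_addHaar (volume : Measure Plane)
    (f := fun d => Real.exp (-(p.mu * c * p.pathLoss d)))]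
  have hb : 0 < p.mu * c * (4 * Real.pi / p.wavelength) ^ 2 :=
    mul_pos (mul_pos p.mu_pos hc) p.pathLoss_coeff_pos
  -- Exponent 1 is the dimension minus one, from the Jacobian of polar coordinates.
  refine (integrableOn_rpow_mul_exp_neg_mul_rpow (s := 1) (by norm_num) p.alpha_pos hb).congr_fun
    (fun d _ => ?_) measurableSet_Ioi
  simp [pathLoss, mul_assoc]

lemma detectIntegral_eq {c : ℝ} (hc : 0 < c) :
    p.detectIntegral c =
      ENNReal.ofReal (∫ z : Plane, Real.exp (-(p.mu * c * p.pathLoss ‖z‖))) :=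
  (ofReal_integral_eq_lintegral_ofReal (p.integrable_detect hc)
    (Filter.Eventually.of_forall fun _ => (Real.exp_pos _).le)).symm

lemma detectIntegral_ne_top {c : ℝ} (hc : 0 < c) : p.detectIntegral c ≠ ∞ := by
  rw [p.detectIntegral_eq hc]
  exact ENNReal.ofReal_ne_top

lemma integral_detect_pos {c : ℝ} (hc : 0 < c) :
    0 < ∫ z : Plane, Real.exp (-(p.mu * c * p.pathLoss ‖z‖)) := by
  rw [integral_pos_iff_support_of_nonneg (fun _ => (Real.exp_pos _).le) (p.integrable_detect hc)]
  have : (Function.support fun z : Plane => Real.exp (-(p.mu * c * p.pathLoss ‖z‖))) =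
      Set.univ := Function.support_eq_univ fun _ => (Real.exp_pos _).ne'
  rw [this]
  exact Measure.measure_univ_pos.2 (NeZero.ne _)

lemma setIntegral_detect (c : ℝ) :
    ∫ z in (Metric.closedBall (0 : Plane) 0)ᶜ, Real.exp (-(p.mu * c * p.pathLoss ‖z - 0‖)) =
      ∫ z : Plane, Real.exp (-(p.mu * c * p.pathLoss ‖z‖)) := by
  rw [Metric.closedBall_zero, restrict_compl_singleton]
  simp

lemma NW3_pos {G : ℝ} (hG : 0 < G) : 0 < p.NW3 G := by
  rw [NW3, NW0, setIntegral_detect]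
  exact mul_pos p.lamW_pos (p.integral_detect_pos (div_pos hG p.PW_pos))

lemma NL3_pos {G : ℝ} (hG : 0 < G) : 0 < p.NL3 G := by
  rw [NL3, NL0, setIntegral_detect]
  exact mul_pos p.lamL_pos (p.integral_detect_pos (div_pos hG p.PL_pos))

lemma ofReal_NW3 {G : ℝ} (hG : 0 < G) :
    ENNReal.ofReal p.lamW * p.detectIntegral (G / p.PW) = ENNReal.ofReal (p.NW3 G) := by
  rw [NW3, NW0, setIntegral_detect, ENNReal.ofReal_mul p.lamW_pos.le,
    p.detectIntegral_eq (div_pos hG p.PW_pos)]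

lemma ofReal_NL3 {G : ℝ} (hG : 0 < G) :
    ENNReal.ofReal p.lamL * p.detectIntegral (G / p.PL) = ENNReal.ofReal (p.NL3 G) := by
  rw [NL3, NL0, setIntegral_detect, ENNReal.ofReal_mul p.lamL_pos.le,
    p.detectIntegral_eq (div_pos hG p.PL_pos)]

end Params

/-! ## The Palm probability of winning the contention -/

section Contention

variable {Ω : Type*} [MeasurableSpace Ω] {P : Measure Ω} [IsProbabilityMeasure P]
  {κ : Type*} {X : κ → Ω → ℝ} {z w : ℕ → Ω → Plane} {lam₁ lam₂ : ℝ}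

/-- Probability that a transmitter at `v` with timer law `T` has a timer below `s` and is detected
at `u`. -/
noncomputable def blockProb (p : Params) (T : Measure ℝ) (c s : ℝ) (u v : Plane) : ℝ≥0∞ :=
  T (Set.Iio s) * p.detect c u v

lemma measurable_measure_Iio (T : Measure ℝ) : Measurable fun s => T (Set.Iio s) :=
  Monotone.measurable fun _ _ h => measure_mono (Set.Iio_subset_Iio h)

lemma measurable_blockProb (p : Params) (T : Measure ℝ) (c : ℝ) {α : Type*} [MeasurableSpace α]
    {s : α → ℝ} {u v : α → Plane} (hs : Measurable s) (hu : Measurable u) (hv : Measurable v) :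
    Measurable fun a => blockProb p T c (s a) (u a) (v a) :=
  ((measurable_measure_Iio T).comp hs).mul ((p.measurable_detect c).comp (hu.prodMk hv))

lemma measurable_thinProd_blockProb (p : Params) (T : Measure ℝ) (c : ℝ) (F : Finset ℕ)
    {α : Type*} [MeasurableSpace α] {v : ℕ → α → Plane} {u : α → Plane} {s : α → ℝ}
    (hv : ∀ i, Measurable (v i)) (hu : Measurable u) (hs : Measurable s) :
    Measurable fun a => thinProd (fun j => v j a) F (blockProb p T c (s a) (u a)) :=
  measurable_thinProd hv F (φ := fun a => blockProb p T c (s a) (u a))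
    (measurable_blockProb p T c (hs.comp measurable_fst) (hu.comp measurable_fst) measurable_snd)

lemma blockProb_self (p : Params) (T : Measure ℝ) (c s : ℝ) (u : Plane) :
    blockProb p T c s u u = 0 := by simp [blockProb, p.detect_self]

lemma blockProb_le_one (p : Params) (T : Measure ℝ) [IsProbabilityMeasure T] {c : ℝ} (hc : 0 < c)
    (s : ℝ) (u v : Plane) : blockProb p T c s u v ≤ 1 :=
  mul_le_one' prob_le_one (p.detect_le_one hc u v)

lemma lowerSemicontinuous_blockProb (p : Params) (T : Measure ℝ) [IsProbabilityMeasure T]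
    (c s : ℝ) : LowerSemicontinuous (Function.uncurry (blockProb p T c s)) :=
  p.lowerSemicontinuous_mul_detect (measure_ne_top _ _) c

lemma lintegral_blockProb (p : Params) (T : Measure ℝ) [IsProbabilityMeasure T] (c s : ℝ)
    (u : Plane) : ∫⁻ v, blockProb p T c s u v = T (Set.Iio s) * p.detectIntegral c := by
  unfold blockProb
  rw [lintegral_const_mul' _ _ (measure_ne_top _ _), p.lintegral_detect]

lemma lintegral_blockProb_ne_top (p : Params) (T : Measure ℝ) [IsProbabilityMeasure T] {c : ℝ}
    (hc : 0 < c) (s : ℝ) (u : Plane) : ∫⁻ v, blockProb p T c s u v ≠ ∞ := by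
  rw [lintegral_blockProb]
  exact ENNReal.mul_ne_top (measure_ne_top _ _) (p.detectIntegral_ne_top hc)

/-- Points `z i` and marks whose timer and gains make `z i` win the contention against the other
points of `z` and all points of `w`. -/
def winSet (p : Params) (X : κ → Ω → ℝ) (z w : ℕ → Ω → Plane) (t : ℕ ⊕ ℕ → κ)
    (g : ℕ → ℕ ⊕ ℕ → κ) (c₁ c₂ : ℝ) (i : ℕ) : Set Ω :=
  {ω | ∀ j, j ≠ i → X (t (.inl j)) ω ≥ X (t (.inl i)) ω ∨
      X (g i (.inl j)) ω / p.pathLoss ‖z j ω - z i ω‖ ≤ c₁} ∩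
    {ω | ∀ m, X (t (.inr m)) ω ≥ X (t (.inl i)) ω ∨
      X (g i (.inr m)) ω / p.pathLoss ‖w m ω - z i ω‖ ≤ c₂}

variable {t : ℕ ⊕ ℕ → κ} {g : ℕ → ℕ ⊕ ℕ → κ} {T₁ T₂ : Measure ℝ} {c₁ c₂ : ℝ}

/-- Both networks are treated as one family of competitors indexed by ℕ ⊕ ℕ and cut off at k, so
that the finite independence statement applies. -/
lemma measure_inter_winSet_truncated (p : Params) (hX : iIndepFun X P)
    (hXm : ∀ m, Measurable (X m)) (hzm : ∀ i, Measurable (z i)) (hwm : ∀ i, Measurable (w i))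
    (hL : IndepFun (fun ω => ((fun i => z i ω : ℕ → Plane), (fun k => w k ω : ℕ → Plane)))
      (fun ω m => X m ω) P)
    (ht : Function.Injective t) (hg : ∀ i, Function.Injective (g i)) (htg : ∀ i a b, t a ≠ g i b)
    (hT₁ : ∀ j, HasLaw (X (t (.inl j))) T₁ P) (hT₂ : ∀ j, HasLaw (X (t (.inr j))) T₂ P)
    (hG : ∀ i j, HasLaw (X (g i j)) (expMeasure p.mu) P) (hc₁ : 0 < c₁) (hc₂ : 0 < c₂)
    {B : Set Plane} (hB : MeasurableSet B) (i k : ℕ) :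
    P ({ω | z i ω ∈ B} ∩ {ω | ∀ j ∈ (Finset.range k \ {i}).disjSum (Finset.range k \ ∅),
        X (t (.inl i)) ω ≤ X (t j) ω ∨ X (g i j) ω /
          p.pathLoss ‖Sum.elim (fun a => z a ω) (fun a => w a ω) j - z i ω‖ ≤
            Sum.elim (fun _ => c₁) (fun _ => c₂) j}) =
      ∫⁻ ω, ∫⁻ s, B.indicator (fun _ => 1) (z i ω) *
        ((∏ j ∈ Finset.range k \ {i}, (1 - blockProb p T₁ c₁ s (z i ω) (z j ω))) *
          ∏ j ∈ Finset.range k \ ∅, (1 - blockProb p T₂ c₂ s (z i ω) (w j ω))) ∂T₁ ∂P := by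
  let c : ℕ ⊕ ℕ → ℝ := Sum.elim (fun _ => c₁) (fun _ => c₂)
  let pt : ℕ ⊕ ℕ → (ℕ → Plane) × (ℕ → Plane) → Plane := fun j l => Sum.elim l.1 l.2 j
  have hpt : ∀ j, Measurable (pt j) := by
    rintro (j | j)
    · exact (measurable_pi_apply j).comp measurable_fst
    · exact (measurable_pi_apply j).comp measurable_snd
  let θ : ℕ ⊕ ℕ → Set (((ℕ → Plane) × (ℕ → Plane)) × ℝ) := fun j =>
    {q | q.2 / p.pathLoss ‖pt j q.1 - pt (.inl i) q.1‖ ≤ c j}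
  have hθ : ∀ j, MeasurableSet (θ j) := fun j => by
    have hd : Measurable fun q : ((ℕ → Plane) × (ℕ → Plane)) × ℝ =>
        p.pathLoss ‖pt j q.1 - pt (.inl i) q.1‖ :=
      p.continuous_pathLoss.measurable.comp
        (((hpt j).sub (hpt (.inl i))).norm.comp measurable_fst)
    have hr : Measurable fun q : ((ℕ → Plane) × (ℕ → Plane)) × ℝ =>
        q.2 / p.pathLoss ‖pt j q.1 - pt (.inl i) q.1‖ := measurable_snd.div hd
    exact hr measurableSet_Iic
  have hLm : Measurable fun ω => ((fun i => z i ω : ℕ → Plane), (fun k => w k ω : ℕ → Plane)) :=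
    (measurable_pi_lambda _ hzm).prodMk (measurable_pi_lambda _ hwm)
  have h1 := measure_inter_forall_timer_le_or_mem hLm hX hXm hL ht (hg i) (htg i) hθ
    ((Finset.range k \ {i}).disjSum (Finset.range k \ ∅)) (u := t (.inl i))
    -- Index i was removed from the own network's summand, so the own timer is not among the
    -- competing ones.
    (fun j hj h => by
      rw [ht h] at hj
      simp at hj)
    (fun j h => htg i _ _ h.symm) (W := {l | pt (.inl i) l ∈ B}) (hpt _ hB)
  refine (congrArg P ?_).trans (h1.trans (lintegral_congr fun ω => ?_))
  · rfl
  have hgain : ∀ j ω, P {ω'' | (((fun i => z i ω : ℕ → Plane), (fun k => w k ω : ℕ → Plane)),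
      X (g i j) ω'') ∉ θ j} =
      p.detect (c j) (z i ω) (Sum.elim (fun a => z a ω) (fun a => w a ω) j) := by
    intro j ω
    have hcj : 0 < c j := by cases j <;> assumption
    rw [← p.expMeasure_detect hcj, ← (hG i j).map_eq, Measure.map_apply (hXm _)]
    · rfl
    · exact (measurableSet_le (measurable_id.div_const _) measurable_const).compl
  have htime₁ : ∀ j s, P {ω | X (t (.inl j)) ω < s} = T₁ (Set.Iio s) := fun j s => by
    rw [← (hT₁ j).map_eq, Measure.map_apply (hXm _) measurableSet_Iio]
    rfl
  have htime₂ : ∀ j s, P {ω | X (t (.inr j)) ω < s} = T₂ (Set.Iio s) := fun j s => by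
    rw [← (hT₂ j).map_eq, Measure.map_apply (hXm _) measurableSet_Iio]
    rfl
  have hm : Measurable fun s => (∏ j ∈ Finset.range k \ {i},
      (1 - blockProb p T₁ c₁ s (z i ω) (z j ω))) *
      ∏ j ∈ Finset.range k \ ∅, (1 - blockProb p T₂ c₂ s (z i ω) (w j ω)) := by
    refine Measurable.mul ?_ ?_ <;> refine Finset.measurable_prod _ fun j _ => ?_ <;>
    exact measurable_const.sub (measurable_blockProb p _ _ measurable_id measurable_const
      measurable_const)
  rw [lintegral_const_mul _ hm]
  congr 1
  rw [← (hT₁ i).lintegral_comp hm.aemeasurable]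
  refine lintegral_congr fun ω' => ?_
  rw [Finset.prod_disjSum]
  simp_rw [hgain, htime₁, htime₂]
  rfl

/-- Let k → ∞ in the truncated identity: continuity from above on the left, dominated convergence on
the right. -/
lemma measure_inter_winSet (p : Params) (hX : iIndepFun X P)
    (hXm : ∀ m, Measurable (X m)) (hzm : ∀ i, Measurable (z i)) (hwm : ∀ i, Measurable (w i))
    (hL : IndepFun (fun ω => ((fun i => z i ω : ℕ → Plane), (fun k => w k ω : ℕ → Plane)))
      (fun ω m => X m ω) P)
    (ht : Function.Injective t) (hg : ∀ i, Function.Injective (g i)) (htg : ∀ i a b, t a ≠ g i b)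
    [IsProbabilityMeasure T₁]
    (hT₁ : ∀ j, HasLaw (X (t (.inl j))) T₁ P) (hT₂ : ∀ j, HasLaw (X (t (.inr j))) T₂ P)
    (hG : ∀ i j, HasLaw (X (g i j)) (expMeasure p.mu) P) (hc₁ : 0 < c₁) (hc₂ : 0 < c₂)
    {B : Set Plane} (hB : MeasurableSet B) (i : ℕ) :
    P ({ω | z i ω ∈ B} ∩ winSet p X z w t g c₁ c₂ i) =
      ∫⁻ q, B.indicator (fun _ => 1) (z i q.1) *
        (thinProd (fun j => z j q.1) {i} (blockProb p T₁ c₁ q.2 (z i q.1)) *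
          thinProd (fun j => w j q.1) ∅ (blockProb p T₂ c₂ q.2 (z i q.1))) ∂(P.prod T₁) := by
  let E : ℕ → Set Ω := fun k => {ω | z i ω ∈ B} ∩
    {ω | ∀ j ∈ (Finset.range k \ {i}).disjSum (Finset.range k \ ∅),
        X (t (.inl i)) ω ≤ X (t j) ω ∨ X (g i j) ω /
          p.pathLoss ‖Sum.elim (fun a => z a ω) (fun a => w a ω) j - z i ω‖ ≤
            Sum.elim (fun _ => c₁) (fun _ => c₂) j}
  have hE : {ω | z i ω ∈ B} ∩ winSet p X z w t g c₁ c₂ i = ⋂ k, E k := by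
    ext ω
    simp only [E, winSet, Set.mem_inter_iff, Set.mem_ofPred_eq, Set.mem_iInter,
      Finset.mem_disjSum]
    constructor
    · rintro ⟨h1, h2, h3⟩ k
      refine ⟨h1, ?_⟩
      rintro _ (⟨j, hj, rfl⟩ | ⟨j, -, rfl⟩)
      · simp only [Finset.mem_sdiff, Finset.mem_singleton] at hj
        exact h2 j hj.2
      · exact h3 j
    · intro h
      refine ⟨(h 0).1, fun j hj => ?_, fun j => ?_⟩
      · exact (h (j + 1)).2 (.inl j) (Or.inl ⟨j, by simp [hj], rfl⟩)
      · exact (h (j + 1)).2 (.inr j) (Or.inr ⟨j, by simp, rfl⟩)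
  have hEanti : Antitone E := by
    intro k l hkl ω hω
    refine ⟨hω.1, fun j hj => hω.2 j (Finset.disjSum_mono ?_ ?_ hj)⟩ <;>
    exact Finset.sdiff_subset_sdiff (Finset.range_mono hkl) le_rfl
  have hEm : ∀ k, MeasurableSet (E k) := by
    intro k
    refine (hzm i hB).inter ?_
    have : {ω | ∀ j ∈ (Finset.range k \ {i}).disjSum (Finset.range k \ ∅),
        X (t (.inl i)) ω ≤ X (t j) ω ∨ X (g i j) ω /
          p.pathLoss ‖Sum.elim (fun a => z a ω) (fun a => w a ω) j - z i ω‖ ≤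
            Sum.elim (fun _ => c₁) (fun _ => c₂) j} =
        ⋂ j ∈ (Finset.range k \ {i}).disjSum (Finset.range k \ ∅),
          ({ω | X (t (.inl i)) ω ≤ X (t j) ω} ∪ {ω | X (g i j) ω /
          p.pathLoss ‖Sum.elim (fun a => z a ω) (fun a => w a ω) j - z i ω‖ ≤
            Sum.elim (fun _ => c₁) (fun _ => c₂) j}) := by
      ext ω
      simp only [Set.mem_ofPred_eq, Set.mem_iInter, Set.mem_union]
    rw [this]
    refine Finset.measurableSet_biInter _ fun j _ => (measurableSet_le (hXm _) (hXm _)).union ?_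
    refine measurableSet_le ((hXm _).div ?_) measurable_const
    refine p.continuous_pathLoss.measurable.comp (Measurable.norm (Measurable.sub ?_ (hzm i)))
    cases j
    · exact hzm _
    · exact hwm _
  have hlim := tendsto_measure_iInter_atTop (μ := P) (fun k => (hEm k).nullMeasurableSet) hEanti
    ⟨0, measure_ne_top _ _⟩
  rw [← hE] at hlim
  let f : ℕ → Ω × ℝ → ℝ≥0∞ := fun k q => B.indicator (fun _ => 1) (z i q.1) *
        ((∏ j ∈ Finset.range k \ {i}, (1 - blockProb p T₁ c₁ q.2 (z i q.1) (z j q.1))) *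
          ∏ j ∈ Finset.range k \ ∅, (1 - blockProb p T₂ c₂ q.2 (z i q.1) (w j q.1)))
  have hf : ∀ k, Measurable (f k) := by
    intro k
    refine ((measurable_const.indicator hB).comp ((hzm i).comp measurable_fst)).mul
      (Measurable.mul ?_ ?_) <;> refine Finset.measurable_prod _ fun j _ => ?_ <;>
    refine measurable_const.sub (measurable_blockProb p _ _ measurable_snd
      ((hzm i).comp measurable_fst) ?_)
    · exact (hzm j).comp measurable_fst
    · exact (hwm j).comp measurable_fst
  have hPE : ∀ k, P (E k) = ∫⁻ q, f k q ∂(P.prod T₁) := by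
    intro k
    rw [lintegral_prod _ (hf k).aemeasurable]
    exact measure_inter_winSet_truncated p hX hXm hzm hwm hL ht hg htg hT₁ hT₂ hG hc₁ hc₂ hB i k
  have hle : ∀ (F : Finset ℕ) (φ : ℕ → ℝ≥0∞), ∏ j ∈ F, (1 - φ j) ≤ 1 := fun F φ =>
    Finset.prod_le_one' fun j _ => tsub_le_self
  refine tendsto_nhds_unique hlim ?_
  change Filter.Tendsto (fun k => P (E k)) _ _
  simp_rw [hPE]
  refine tendsto_lintegral_of_dominated_convergence (fun _ => 1) hf (fun k => ?_) (by simp) ?_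
  · refine Filter.Eventually.of_forall fun q => ?_
    refine mul_le_one' ?_ (mul_le_one' (hle _ _) (hle _ _))
    by_cases hq : z i q.1 ∈ B <;> simp [hq]
  · refine Filter.Eventually.of_forall fun q => ?_
    refine ENNReal.Tendsto.const_mul (ENNReal.Tendsto.mul
      (tendsto_atTop_iInf (antitone_prod_range_sdiff _ _))
      (Or.inr (ne_top_of_le_ne_top ENNReal.one_ne_top (thinProd_le_one _ _ _)))
      (tendsto_atTop_iInf (antitone_prod_range_sdiff _ _))
      (Or.inr (ne_top_of_le_ne_top ENNReal.one_ne_top (thinProd_le_one _ _ _)))) (Or.inr ?_)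
    by_cases hq : z i q.1 ∈ B <;> simp [hq]

theorem palmProb_winSet (p : Params) (hX : iIndepFun X P)
    (hXm : ∀ m, Measurable (X m)) (hlam₁ : 0 < lam₁) (hlam₂ : 0 < lam₂)
    (hz : IsPoissonProcess P lam₁ z) (hw : IsPoissonProcess P lam₂ w)
    (hzw : IndepFun (fun ω i => z i ω) (fun ω k => w k ω) P)
    (hL : IndepFun (fun ω => ((fun i => z i ω : ℕ → Plane), (fun k => w k ω : ℕ → Plane)))
      (fun ω m => X m ω) P)
    (ht : Function.Injective t) (hg : ∀ i, Function.Injective (g i)) (htg : ∀ i a b, t a ≠ g i b)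
    [IsProbabilityMeasure T₁] [IsProbabilityMeasure T₂]
    (hT₁ : ∀ j, HasLaw (X (t (.inl j))) T₁ P) (hT₂ : ∀ j, HasLaw (X (t (.inr j))) T₂ P)
    (hG : ∀ i j, HasLaw (X (g i j)) (expMeasure p.mu) P) (hc₁ : 0 < c₁) (hc₂ : 0 < c₂)
    {B : Set Plane} (hB : MeasurableSet B) (hB0 : volume B ≠ 0) (hBfin : volume B ≠ ∞) :
    palmProb P lam₁ z (winSet p X z w t g c₁ c₂) B =
      ∫⁻ s, expNeg (ENNReal.ofReal lam₁ * (T₁ (Set.Iio s) * p.detectIntegral c₁)) *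
        expNeg (ENNReal.ofReal lam₂ * (T₂ (Set.Iio s) * p.detectIntegral c₂)) ∂T₁ := by
  have hzm := hz.measurable
  have hwm := hw.measurable
  let f : ℕ → Ω × ℝ → ℝ≥0∞ := fun i q => B.indicator (fun _ => 1) (z i q.1) *
        (thinProd (fun j => z j q.1) {i} (blockProb p T₁ c₁ q.2 (z i q.1)) *
          thinProd (fun j => w j q.1) ∅ (blockProb p T₂ c₂ q.2 (z i q.1)))
  have hf : ∀ i, Measurable (f i) := fun i =>
    ((measurable_const.indicator hB).comp ((hzm i).comp measurable_fst)).mul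
      ((measurable_thinProd_blockProb p T₁ c₁ {i} (fun j => (hzm j).comp measurable_fst)
        ((hzm i).comp measurable_fst) measurable_snd).mul
      (measurable_thinProd_blockProb p T₂ c₂ ∅ (fun j => (hwm j).comp measurable_fst)
        ((hzm i).comp measurable_fst) measurable_snd))
  have hEm : ∀ i, MeasurableSet ({ω | z i ω ∈ B} ∩ winSet p X z w t g c₁ c₂ i) := by
    intro i
    have hpl := p.continuous_pathLoss.measurable
    have : winSet p X z w t g c₁ c₂ i =
        (⋂ (j : ℕ) (_ : j ≠ i), ({ω | X (t (.inl j)) ω ≥ X (t (.inl i)) ω} ∪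
          {ω | X (g i (.inl j)) ω / p.pathLoss ‖z j ω - z i ω‖ ≤ c₁})) ∩
        ⋂ m : ℕ, ({ω | X (t (.inr m)) ω ≥ X (t (.inl i)) ω} ∪
          {ω | X (g i (.inr m)) ω / p.pathLoss ‖w m ω - z i ω‖ ≤ c₂}) := by
      ext ω
      simp only [winSet, Set.mem_inter_iff, Set.mem_ofPred_eq, Set.mem_iInter, Set.mem_union]
    rw [this]
    refine (hzm i hB).inter (MeasurableSet.inter ?_ ?_)
    · exact MeasurableSet.iInter fun j => MeasurableSet.iInter fun _ =>
        (measurableSet_le (hXm _) (hXm _)).union (measurableSet_le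
          ((hXm _).div (hpl.comp ((hzm j).sub (hzm i)).norm)) measurable_const)
    · exact MeasurableSet.iInter fun j =>
        (measurableSet_le (hXm _) (hXm _)).union (measurableSet_le
          ((hXm _).div (hpl.comp ((hwm j).sub (hzm i)).norm)) measurable_const)
  -- With z frozen, averaging over w gives a Laplace functional that does not depend on the position
  -- of z i, so it comes out as a constant.
  have hfactor : ∀ i s, ∫⁻ ω, f i (ω, s) ∂P =
      (∫⁻ ω, B.indicator (fun _ => 1) (z i ω) *
        thinProd (fun j => z j ω) {i} (blockProb p T₁ c₁ s (z i ω)) ∂P) *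
      expNeg (ENNReal.ofReal lam₂ * (T₂ (Set.Iio s) * p.detectIntegral c₂)) := by
    intro i s
    let F : (ℕ → Plane) × (ℕ → Plane) → ℝ≥0∞ := fun l => B.indicator (fun _ => 1) (l.1 i) *
      (thinProd (fun j => l.1 j) {i} (blockProb p T₁ c₁ s (l.1 i)) *
        thinProd (fun j => l.2 j) ∅ (blockProb p T₂ c₂ s (l.1 i)))
    have hev₁ : ∀ j, Measurable fun l : (ℕ → Plane) × (ℕ → Plane) => l.1 j := fun j =>
      (measurable_pi_apply j).comp measurable_fst
    have hev₂ : ∀ j, Measurable fun l : (ℕ → Plane) × (ℕ → Plane) => l.2 j := fun j =>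
      (measurable_pi_apply j).comp measurable_snd
    have hF : Measurable F := ((measurable_const.indicator hB).comp (hev₁ i)).mul
      ((measurable_thinProd_blockProb p T₁ c₁ {i} hev₁ (hev₁ i) measurable_const).mul
      (measurable_thinProd_blockProb p T₂ c₂ ∅ hev₂ (hev₁ i) measurable_const))
    have h1 := lintegral_comp_of_indepFun hzw (measurable_pi_lambda _ hzm)
      (measurable_pi_lambda _ hwm) hF
    refine h1.trans ?_
    have hmw : ∀ u, Measurable fun ω =>
        thinProd (fun j => w j ω) ∅ (blockProb p T₂ c₂ s u) := fun u =>
      measurable_thinProd_blockProb p T₂ c₂ ∅ hwm measurable_const measurable_const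
    have hmz : Measurable fun ω => B.indicator (fun _ => (1 : ℝ≥0∞)) (z i ω) *
        thinProd (fun j => z j ω) {i} (blockProb p T₁ c₁ s (z i ω)) :=
      ((measurable_const.indicator hB).comp (hzm i)).mul
        (measurable_thinProd_blockProb p T₁ c₁ {i} hzm (hzm i) measurable_const)
    rw [← lintegral_mul_const _ hmz]
    refine lintegral_congr fun ω => ?_
    simp only [F, ← mul_assoc]
    rw [lintegral_const_mul _ (hmw _), hw.lintegral_thinProd hlam₂.le (blockProb_self p T₂ c₂ s)
      (blockProb_le_one p T₂ hc₂ s) (lowerSemicontinuous_blockProb p T₂ c₂ s) _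
      (lintegral_blockProb_ne_top p T₂ hc₂ s _), lintegral_blockProb]
    simp only [mul_assoc]
  have hnum : ∫⁻ ω, ∑' i, ({ω' | z i ω' ∈ B} ∩ winSet p X z w t g c₁ c₂ i).indicator
      (fun _ => (1 : ℝ≥0∞)) ω ∂P =
      (∫⁻ s, expNeg (ENNReal.ofReal lam₁ * (T₁ (Set.Iio s) * p.detectIntegral c₁)) *
        expNeg (ENNReal.ofReal lam₂ * (T₂ (Set.Iio s) * p.detectIntegral c₂)) ∂T₁) *
      (ENNReal.ofReal lam₁ * volume B) := by
    rw [lintegral_tsum fun i => (measurable_const.indicator (hEm i)).aemeasurable]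
    have h1 : ∀ i, ∫⁻ ω, ({ω' | z i ω' ∈ B} ∩ winSet p X z w t g c₁ c₂ i).indicator
        (fun _ => (1 : ℝ≥0∞)) ω ∂P = ∫⁻ s, ∫⁻ ω, f i (ω, s) ∂P ∂T₁ := by
      intro i
      rw [lintegral_indicator_const (hEm i), one_mul,
        measure_inter_winSet p hX hXm hzm hwm hL ht hg htg hT₁ hT₂ hG hc₁ hc₂ hB i,
        lintegral_prod_symm _ (hf i).aemeasurable]
    simp_rw [h1]
    -- Mecke's formula is used for each fixed timer value s, so the sum over points must go inside
    -- the integral over s.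
    rw [← lintegral_tsum fun i => (hf i).lintegral_prod_left'.aemeasurable]
    have hmeas : ∀ (lam : ℝ) (T : Measure ℝ) (c : ℝ), Measurable fun s =>
        expNeg (ENNReal.ofReal lam * (T (Set.Iio s) * p.detectIntegral c)) := fun lam T c =>
      measurable_expNeg.comp (((measurable_measure_Iio T).mul_const _).const_mul _)
    have hmeas' : Measurable fun s =>
        expNeg (ENNReal.ofReal lam₁ * (T₁ (Set.Iio s) * p.detectIntegral c₁)) *
        expNeg (ENNReal.ofReal lam₂ * (T₂ (Set.Iio s) * p.detectIntegral c₂)) :=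
      (hmeas _ _ _).mul (hmeas _ _ _)
    rw [← lintegral_mul_const _ hmeas']
    refine lintegral_congr fun s => ?_
    simp_rw [hfactor]
    rw [ENNReal.tsum_mul_right, hz.tsum_lintegral_thinProd hlam₁.le (blockProb_self p T₁ c₁ s)
      (blockProb_le_one p T₁ hc₁ s) (lowerSemicontinuous_blockProb p T₁ c₁ s)
      (lintegral_blockProb_ne_top p T₁ hc₁ s) hB hBfin]
    simp_rw [lintegral_blockProb]
    rw [lintegral_const, Measure.restrict_apply_univ]
    ring
  rw [palmProb, hnum]
  refine ENNReal.mul_div_cancel_right ?_ ?_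
  · exact mul_ne_zero (ENNReal.ofReal_pos.2 hlam₁).ne' hB0
  · exact ENNReal.mul_ne_top ENNReal.ofReal_ne_top hBfin

end Contention

/-! ## Uniform timers -/

lemma cond_volume_Icc {a b : ℝ} (hab : b = a + 1) :
    cond volume (Set.Icc a b) = volume.restrict (Set.Icc a b) := by
  simp [ProbabilityTheory.cond, hab]

lemma cond_volume_Icc_Iio {a b s : ℝ} (hab : b = a + 1) (hs : s ∈ Set.Icc a b) :
    cond volume (Set.Icc a b) (Set.Iio s) = ENNReal.ofReal (s - a) := by
  have : Set.Iio s ∩ Set.Icc a b = Set.Ico a s := by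
    ext r
    simp only [Set.mem_inter_iff, Set.mem_Iio, Set.mem_Icc, Set.mem_Ico]
    exact ⟨fun h => ⟨h.2.1, h.1⟩, fun h => ⟨h.2, h.1, h.2.le.trans hs.2⟩⟩
  rw [cond_volume_Icc hab, Measure.restrict_apply measurableSet_Iio, this, Real.volume_Ico]

lemma cond_volume_Icc_Iio_of_le {a b s : ℝ} (hab : b = a + 1) (hs : s ≤ a) :
    cond volume (Set.Icc a b) (Set.Iio s) = 0 := by
  have : Set.Iio s ∩ Set.Icc a b = ∅ := by
    ext r
    simp only [Set.mem_inter_iff, Set.mem_Iio, Set.mem_Icc, Set.mem_empty_iff_false, iff_false]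
    rintro ⟨h1, h2, -⟩
    linarith
  rw [cond_volume_Icc hab, Measure.restrict_apply measurableSet_Iio, this, measure_empty]

lemma isProbabilityMeasure_cond_volume_Icc {a b : ℝ} (hab : b = a + 1) :
    IsProbabilityMeasure (cond (volume : Measure ℝ) (Set.Icc a b)) :=
  ⟨by rw [cond_volume_Icc hab]; simp [hab]⟩

lemma cond_volume_Icc_Iio_of_ge {a b s : ℝ} (hab : b = a + 1) (hs : b ≤ s) :
    cond volume (Set.Icc a b) (Set.Iio s) = 1 := by
  have := isProbabilityMeasure_cond_volume_Icc hab
  refine le_antisymm prob_le_one ?_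
  calc (1 : ℝ≥0∞) = cond volume (Set.Icc a b) (Set.Iio b) := by
        rw [cond_volume_Icc_Iio hab ⟨by linarith, le_rfl⟩]
        simp [hab]
    _ ≤ _ := measure_mono (Set.Iio_subset_Iio hs)

lemma ae_cond_volume_Icc {a b : ℝ} (hab : b = a + 1) :
    ∀ᵐ s ∂(cond volume (Set.Icc a b)), s ∈ Set.Icc a b := by
  rw [cond_volume_Icc hab]
  exact ae_restrict_mem measurableSet_Icc

lemma integral_Icc_exp {a b N : ℝ} (hab : b = a + 1) (hN : 0 < N) :
    ∫ s in Set.Icc a b, Real.exp (-(N * (s - a))) = (1 - Real.exp (-N)) / N := by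
  have hderiv : ∀ s : ℝ, HasDerivAt (fun s => -(Real.exp (-(N * (s - a))) / N))
      (Real.exp (-(N * (s - a)))) s := by
    intro s
    have h1 : HasDerivAt (fun s : ℝ => -(N * (s - a))) (-(N * 1)) s :=
      (((hasDerivAt_id s).sub_const a).const_mul N).neg
    refine (h1.exp.div_const N).neg.congr_deriv ?_
    field_simp
  rw [integral_Icc_eq_integral_Ioc, ← intervalIntegral.integral_of_le (by linarith),
    intervalIntegral.integral_eq_sub_of_hasDerivAt (fun s _ => hderiv s)
      (Continuous.intervalIntegrable (by fun_prop) _ _), hab]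
  simp
  ring

/-- On the support a competitor's timer is below s with probability s - a, so the integrand is
exp(-N(s-a)). -/
lemma lintegral_expNeg_uniform {a b N : ℝ} (hab : b = a + 1) (hN : 0 < N) {l I : ℝ≥0∞}
    (hl : l * I = ENNReal.ofReal N) :
    ∫⁻ s, expNeg (l * (cond volume (Set.Icc a b) (Set.Iio s) * I)) ∂(cond volume (Set.Icc a b)) =
      ENNReal.ofReal ((1 - Real.exp (-N)) / N) := by
  have h1 : ∀ᵐ s ∂(cond volume (Set.Icc a b)),
      expNeg (l * (cond volume (Set.Icc a b) (Set.Iio s) * I)) =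
        ENNReal.ofReal (Real.exp (-(N * (s - a)))) := by
    filter_upwards [ae_cond_volume_Icc hab] with s hs
    rw [cond_volume_Icc_Iio hab hs, mul_left_comm, hl, mul_comm, ← ENNReal.ofReal_mul hN.le,
      expNeg, ENNReal.toReal_ofReal (mul_nonneg hN.le (sub_nonneg.2 hs.1))]
  rw [lintegral_congr_ae h1, cond_volume_Icc hab, ← ofReal_integral_eq_lintegral_ofReal,
    integral_Icc_exp hab hN]
  · exact (Continuous.continuousOn (by fun_prop)).integrableOn_Icc
  · exact Filter.Eventually.of_forall fun _ => (Real.exp_pos _).le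

/-! ### Access probabilities for timers on [0,1] and [1,2] -/

namespace Network

variable {Ω : Type*} [MeasurableSpace Ω] {P : Measure Ω} {p : Params}

/-- Almost surely every AP timer is at most 1 and every eNB timer at least 1, so the LTE condition
holds automatically and the two events agree outside a null set. -/
lemma mapW_eq_mapWithoutLTE (S : Network P p 1 2) (B : Set Plane) :
    S.mapW B = S.mapWithoutLTE B := by
  have hW : ∀ᵐ ω ∂P, ∀ i, S.mark (.tW i) ω ∈ Set.Icc (0 : ℝ) 1 := ae_all_iff.2 fun i =>
    ((S.hasLaw_mark (.tW i)).ae_iff (p := (· ∈ Set.Icc (0 : ℝ) 1)) measurableSet_Icc.mem).2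
      (ae_cond_volume_Icc (by norm_num))
  have hL : ∀ᵐ ω ∂P, ∀ k, S.mark (.tL k) ω ∈ Set.Icc (1 : ℝ) 2 := ae_all_iff.2 fun k =>
    ((S.hasLaw_mark (.tL k)).ae_iff (p := (· ∈ Set.Icc (1 : ℝ) 2)) measurableSet_Icc.mem).2
      (ae_cond_volume_Icc (by norm_num))
  unfold mapW mapWithoutLTE palmProb
  congr 1
  refine lintegral_congr_ae ?_
  filter_upwards [hW, hL] with ω hω hω'
  refine tsum_congr fun i => ?_
  have : ω ∈ {ω' | S.x i ω' ∈ B} ∩ S.accessW i ↔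
      ω ∈ {ω' | S.x i ω' ∈ B} ∩ S.accessWithoutLTE i :=
    and_congr_right fun _ => and_iff_left fun m => Or.inl ((hω i).2.trans (hω' m).1)
  by_cases h : ω ∈ {ω' | S.x i ω' ∈ B} ∩ S.accessW i
  · rw [Set.indicator_of_mem h, Set.indicator_of_mem (this.1 h)]
  · rw [Set.indicator_of_notMem h, Set.indicator_of_notMem (mt this.2 h)]

variable [IsProbabilityMeasure P]

lemma mapW_eq (S : Network P p 1 2) {B : Set Plane} (hB : MeasurableSet B) (hB0 : volume B ≠ 0)
    (hBtop : volume B ≠ ∞) :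
    S.mapW B = ENNReal.ofReal ((1 - Real.exp (-p.NW)) / p.NW) := by
  have := isProbabilityMeasure_cond_volume_Icc (a := 0) (b := 1) (by norm_num)
  have := isProbabilityMeasure_cond_volume_Icc (a := 1) (b := 2) (by norm_num)
  have h := palmProb_winSet p S.iIndepFun_mark S.measurable_mark p.lamW_pos p.lamL_pos
    S.poisson_x S.poisson_y S.indepFun_locations S.indepFun_locations_mark
    (t := Sum.elim Mark.tW Mark.tL)
    (g := fun i => Sum.elim (fun j => Mark.gW j i) (fun m => Mark.gLW m i))
    (T₁ := cond volume (Set.Icc 0 1)) (T₂ := cond volume (Set.Icc 1 2))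
    (by rintro (a | a) (b | b) h <;> simp_all)
    (by rintro i (a | a) (b | b) h <;> simp_all)
    (by rintro i (a | a) (b | b) <;> simp)
    (fun j => S.hasLaw_mark (.tW j)) (fun j => S.hasLaw_mark (.tL j))
    (by rintro i (j | j)
        · exact S.hasLaw_mark (.gW j i)
        · exact S.hasLaw_mark (.gLW j i))
    (div_pos p.Gcs_pos p.PW_pos) (div_pos p.Ged_pos p.PL_pos) hB hB0 hBtop
  refine Eq.trans h ?_
  change _ = ENNReal.ofReal ((1 - Real.exp (-p.NW3 p.Gcs)) / p.NW3 p.Gcs)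
  rw [← lintegral_expNeg_uniform (a := 0) (b := 1) (by norm_num) (p.NW3_pos p.Gcs_pos)
    (p.ofReal_NW3 p.Gcs_pos)]
  refine lintegral_congr_ae ?_
  filter_upwards [ae_cond_volume_Icc (a := 0) (b := 1) (by norm_num)] with s hs
  -- Since s ≤ 1, no eNB timer falls below s and the LTE factor is 1.
  rw [cond_volume_Icc_Iio_of_le (a := 1) (b := 2) (by norm_num) hs.2, zero_mul, mul_zero,
    expNeg_zero, mul_one]

lemma mapL_eq (S : Network P p 1 2) {B : Set Plane} (hB : MeasurableSet B) (hB0 : volume B ≠ 0)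
    (hBtop : volume B ≠ ∞) :
    S.mapL B = ENNReal.ofReal
      (Real.exp (-p.NW3 p.Glte) * ((1 - Real.exp (-p.NL3 p.Glte)) / p.NL3 p.Glte)) := by
  have := isProbabilityMeasure_cond_volume_Icc (a := 0) (b := 1) (by norm_num)
  have := isProbabilityMeasure_cond_volume_Icc (a := 1) (b := 2) (by norm_num)
  have h := palmProb_winSet p S.iIndepFun_mark S.measurable_mark p.lamL_pos p.lamW_pos
    S.poisson_y S.poisson_x S.indepFun_locations.symm
    (S.indepFun_locations_mark.comp measurable_swap measurable_id)
    (t := Sum.elim Mark.tL Mark.tW)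
    (g := fun i => Sum.elim (fun j => Mark.gL j i) (fun m => Mark.gWL m i))
    (T₁ := cond volume (Set.Icc 1 2)) (T₂ := cond volume (Set.Icc 0 1))
    (by rintro (a | a) (b | b) h <;> simp_all)
    (by rintro i (a | a) (b | b) h <;> simp_all)
    (by rintro i (a | a) (b | b) <;> simp)
    (fun j => S.hasLaw_mark (.tL j)) (fun j => S.hasLaw_mark (.tW j))
    (by rintro i (j | j)
        · exact S.hasLaw_mark (.gL j i)
        · exact S.hasLaw_mark (.gWL j i))
    (div_pos p.Glte_pos p.PL_pos) (div_pos p.Glte_pos p.PW_pos) hB hB0 hBtop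
  have hA : S.accessL = winSet p S.mark S.y S.x (Sum.elim Mark.tL Mark.tW)
      (fun i => Sum.elim (fun j => Mark.gL j i) (fun m => Mark.gWL m i))
      (p.Glte / p.PL) (p.Glte / p.PW) := funext fun k => Set.inter_comm _ _
  rw [mapL, hA, h, ENNReal.ofReal_mul (Real.exp_pos _).le,
    ← lintegral_expNeg_uniform (a := 1) (b := 2) (by norm_num) (p.NL3_pos p.Glte_pos)
    (p.ofReal_NL3 p.Glte_pos),
    ← lintegral_const_mul' _ _ ENNReal.ofReal_ne_top]
  refine lintegral_congr_ae ?_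
  filter_upwards [ae_cond_volume_Icc (a := 1) (b := 2) (by norm_num)] with s hs
  -- Since s ≥ 1, an AP timer is below s with probability 1, so the Wi-Fi factor is constant in s.
  rw [cond_volume_Icc_Iio_of_ge (a := 0) (b := 1) (by norm_num) hs.1, one_mul,
    p.ofReal_NW3 p.Glte_pos, mul_comm, expNeg,
    ENNReal.toReal_ofReal (p.NW3_pos p.Glte_pos).le]

end Network

end Coexistence

theorem mainTheorem10 {Ω : Type*} [MeasurableSpace Ω] (P : Measure Ω) [IsProbabilityMeasure P]
    (p : Coexistence.Params) (S : Coexistence.Network P p 1 2)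
    (B : Set Coexistence.Plane) (hB : MeasurableSet B) (hB0 : volume B ≠ 0)
    (hBtop : volume B ≠ ∞) :
    S.mapW B = ENNReal.ofReal ((1 - Real.exp (-p.NW)) / p.NW) ∧
    S.mapW B = S.mapWithoutLTE B ∧
    S.mapL B = ENNReal.ofReal
      (Real.exp (-p.NW3 p.Glte) * ((1 - Real.exp (-p.NL3 p.Glte)) / p.NL3 p.Glte)) :=
  ⟨S.mapW_eq hB hB0 hBtop, S.mapW_eq_mapWithoutLTE B, S.mapL_eq hB hB0 hBtop⟩
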